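/- Let $n\ge 1$ be an integer, let $\mathbb B$ be the open unit ball of $\mathbb C^n$ and $\mathbb S$ its boundary sphere, let $dV$ be the normalized volume measure on $\mathbb B$ and $\sigma$ the normalized surface measure on $\mathbb S$ ($V(\mathbb B)=\sigma(\mathbb S)=1$), and write $\langle z,a\rangle=\sum_i z_i\overline{a_i}$. For $a\in\mathbb B$ put $$\Phi_a(z)=\frac{a-P_az-s_aQ_az}{1-\langle z,a\rangle},\qquad s_a=\sqrt{1-|a|^2},$$ where $P_a$ is the orthogonal projection of $\mathbb C^n$ onto the linear span of $a$ and $Q_a=I-P_a$. For $p>0$ let $\mathcal N_p$ be the space of all holomorphic $f$ on $\mathbb B$ with $$\|f\|_p=\sup_{a\in\mathbb B}\Big(\int_{\mathbb B}|f(z)|^2\big(1-|\Phi_a(z)|^2\big)^p\,dV(z)\Big)^{1/2}<\infty,$$ and let $\mathcal N_p^0$ be the set of all $f\in\mathcal N_p$ with $\lim_{|a|\to1^-}\int_{\mathbb B}|f(z)|^2(1-|\Phi_a(z)|^2)^p\,dV(z)=0$. Let $p$ be real with $0<p\le n$, and let $f$ be a holomorphic function on $\mathbb B$ with Hadamard gaps,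 that is, $f(z)=\sum_{k=0}^\infty P_{n_k}(z)$ for all $z\in\mathbb B$, where $P_{n_k}$ is a homogeneous polynomial of degree $n_k$ (possibly zero), $n_0<n_1<\cdots$ are non-negative integers, and there is a constant $c>1$ with $n_{k+1}\ge c\,n_k$ for all $k\ge0$. Put $$M_k=\sup_{\xi\in\mathbb S}|P_{n_k}(\xi)|,\qquad L_k=\Big(\int_{\mathbb S}|P_{n_k}(\xi)|^2\,d\sigma(\xi)\Big)^{1/2}.$$ Consider the following statements: (a) $\displaystyle\sum_{k=0}^\infty\Big(\frac1{2^{k(1+p)}}\sum_{2^k\le n_j<2^{k+1}}M_j^2\Big)<\infty$; (b) $f\in\mathcal N_p^0$; (c) $f\in\mathcal N_p$; (d) $\displaystyle\sum_{k=0}^\infty\Big(\frac1{2^{k(1+p)}}\sum_{2^k\le n_j<2^{k+1}}L_j^2\Big)<\infty$. Then (a) $\Rightarrow$ (b) $\Rightarrow$ (c) $\Rightarrow$ (d). -/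

import Mathlib

open MeasureTheory Filter Topology Metric
open scoped ENNReal

noncomputable section

namespace HadamardNp

/-- `ℂⁿ` with its Euclidean norm. The open unit ball is `ball (0 : Cn n) 1`,
the unit sphere is `sphere (0 : Cn n) 1`. -/
abbrev Cn (n : ℕ) : Type := EuclideanSpace ℂ (Fin n)

/-- Lebesgue measure on the unit ball of `ℂⁿ`, normalized to total mass one. -/
def ballMeasure (n : ℕ) : Measure (Cn n) :=
  (volume (ball (0 : Cn n) 1))⁻¹ • volume.restrict (ball (0 : Cn n) 1)

/-- Surface measure on the unit sphere of `ℂⁿ`, normalized to total mass one. -/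
def sphereMeasure (n : ℕ) : Measure (sphere (0 : Cn n) 1) :=
  ((volume : Measure (Cn n)).toSphere Set.univ)⁻¹ • (volume : Measure (Cn n)).toSphere

/-- The map `Φ_a(z) = (a - P_a z - s_a Q_a z) / (1 - ⟨z, a⟩)`, where `P_a` is the orthogonal
projection onto the span of `a`, `Q_a = I - P_a` and `s_a = √(1 - |a|²)`. The product
`⟨z, a⟩ = ∑ z_i conj(a_i)` is linear in `z`, so it is `inner ℂ a z` in Mathlib. -/
def ballAut {n : ℕ} (a z : Cn n) : Cn n :=
  (1 - inner ℂ a z)⁻¹ •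
    (a - (Submodule.span ℂ {a}).starProjection z
      - ((Real.sqrt (1 - ‖a‖ ^ 2) : ℝ) : ℂ) • (z - (Submodule.span ℂ {a}).starProjection z))

/-- The integral `∫_B |f(z)|² (1 - |Φ_a(z)|²)^p dV(z)`, with values in `[0, ∞]`. -/
def npIntegral {n : ℕ} (p : ℝ) (f : Cn n → ℂ) (a : Cn n) : ℝ≥0∞ :=
  ∫⁻ z, ENNReal.ofReal (‖f z‖ ^ 2 * (1 - ‖ballAut a z‖ ^ 2) ^ p) ∂(ballMeasure n)

/-- The norm `‖f‖_p`, with values in `[0, ∞]`. -/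
def npNorm {n : ℕ} (p : ℝ) (f : Cn n → ℂ) : ℝ≥0∞ :=
  ⨆ a ∈ ball (0 : Cn n) 1, npIntegral p f a ^ (1 / 2 : ℝ)

/-- The space `N_p` of the unit ball of `ℂⁿ`. -/
def Np (n : ℕ) (p : ℝ) : Set (Cn n → ℂ) :=
  {f | DifferentiableOn ℂ f (ball 0 1) ∧ npNorm p f < ∞}

/-- The little space `N_p⁰`: the functions in `N_p` whose integrals tend to `0`
as `|a| → 1⁻`. -/
def NpLittle (n : ℕ) (p : ℝ) : Set (Cn n → ℂ) :=
  {f | f ∈ Np n p ∧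
    Tendsto (fun a : Cn n => npIntegral p f a)
      (comap (fun a : Cn n => ‖a‖) (𝓝[<] (1 : ℝ))) (𝓝 0)}

/-- A sequence of degrees with Hadamard gaps: `d (k+1) / d k ≥ c` for some `c > 1` and all `k`.
In product form this is `c * d k ≤ d (k+1)`; the strict increase is automatic where `d k > 0` and
in case `d 0 = 0` says `d 1 > 0` (ratio `∞`). -/
def HadamardGaps (d : ℕ → ℕ) : Prop :=
  StrictMono d ∧ ∃ c : ℝ, 1 < c ∧ ∀ k, c * (d k : ℝ) ≤ (d (k + 1) : ℝ)

/-- The sup-norm of a polynomial on the unit sphere. -/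
def sphereSup {n : ℕ} (P : MvPolynomial (Fin n) ℂ) : ℝ :=
  ⨆ ξ : sphere (0 : Cn n) 1, ‖MvPolynomial.eval (fun i => (ξ : Cn n) i) P‖

/-- The `L²`-norm of a polynomial on the unit sphere. -/
def sphereL2 {n : ℕ} (P : MvPolynomial (Fin n) ℂ) : ℝ :=
  Real.sqrt (∫ ξ : sphere (0 : Cn n) 1,
    ‖MvPolynomial.eval (fun i => (ξ : Cn n) i) P‖ ^ 2 ∂(sphereMeasure n))

/-- The dyadic sum `∑_k 2^{-k(1+p)} ∑_{j : 2^k ≤ d j < 2^{k+1}} (x j)²`, with values in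
`[0, ∞]`. -/
def dyadicSum (p : ℝ) (d : ℕ → ℕ) (x : ℕ → ℝ) : ℝ≥0∞ :=
  ∑' k : ℕ, ENNReal.ofReal (1 / (2 : ℝ) ^ ((k : ℝ) * (1 + p))) *
    ∑' j : {j : ℕ // 2 ^ k ≤ d j ∧ d j < 2 ^ (k + 1)}, ENNReal.ofReal (x j ^ 2)

end HadamardNp

end

/-!
The identity `1 - |Φ_a(z)|² = (1 - |a|²)(1 - |z|²) / |1 - ⟨z, a⟩|²` (`one_sub_norm_sq_ballAut`)
turns the integrals defining `N_p` into integrals of `|f(z)|² (1 - |z|²)^p` against the kernel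
`κ_a(z) = ((1 - |a|²) / |1 - ⟨z, a⟩|²)^p`.

From `f ∈ N_p` to the `L²` norms only `a = 0` is used, where the kernel is `1`. Homogeneous
polynomials of different degrees are orthogonal for every rotation-invariant measure
(`lintegral_norm_sq_sum_homogeneous`), so the integral is the sum over `k` of `L_k²` times a radial
integral, which is at least a constant times `(n_k + 1)^(-(1 + p))` (`radial_weight_ge`). Up to
constants and the term of degree zero, the dyadic sum is `∑ L_k² (n_k + 1)^(-(1 + p))`
(`dyadicSum_le`, `tsum_lt_top_of_dyadicSum_lt_top`).

From the sup norms to `N_p⁰`, the Cauchy–Schwarz inequality with the weights `(n_j + 1)^p` and the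
lacunary estimate `∑ (n_j + 1)^p r^(n_j) ≤ C (1 - r)^(-p)` (`HadamardGaps.tsum_rpow_mul_pow_le`)
give `|f(z)|² (1 - |z|²)^p ≤ C G(|z|)` with `G(r) = ∑ M_j² (n_j + 1)^(-p) r^(n_j)`, and the integral
of `G` over `(0, 1)` is `∑ M_j² (n_j + 1)^(-(1 + p))`, which is finite. In polar coordinates it
remains to control the sphere averages of `κ_a`. They are at most `1` (`lintegral_kernel_rpow_le`):
for `p = n` the average is at most that of the invariant Poisson kernel, which is computed by
expanding in powers of `⟨ξ, a⟩` (`lintegral_poisson_kernel`), and `p < n` follows by Hölder's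
inequality; this is where `p ≤ n` enters. For a fixed radius `r < 1` they tend to `0` as `|a| → 1`,
so dominated convergence gives the little space.
-/

namespace HadamardNp

/-! ### Polar coordinates -/

section Polar

variable {E : Type*} [NormedAddCommGroup E] [NormedSpace ℝ E] [MeasurableSpace E] [BorelSpace E]
  [FiniteDimensional ℝ E] [Nontrivial E]

theorem lintegral_eq_lintegral_polar (μ : Measure E) [μ.IsAddHaarMeasure] {g : E → ℝ≥0∞}
    (hg : Measurable g) :
    ∫⁻ x, g x ∂μ = ∫⁻ r in Set.Ioi (0 : ℝ), ENNReal.ofReal (r ^ (Module.finrank ℝ E - 1)) *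
      ∫⁻ ξ : sphere (0 : E) 1, g (r • (ξ : E)) ∂μ.toSphere := by
  have hsm : Measurable fun y : sphere (0 : E) 1 × Set.Ioi (0 : ℝ) =>
      g ((y.2 : ℝ) • (y.1 : E)) := by fun_prop
  have hin : Measurable fun r : ℝ =>
      ∫⁻ ξ : sphere (0 : E) 1, g (r • (ξ : E)) ∂μ.toSphere := by
    refine Measurable.lintegral_prod_right' (f := fun y : ℝ × sphere (0 : E) 1 =>
      g (y.1 • (y.2 : E))) ?_
    fun_prop
  calc ∫⁻ x, g x ∂μ = ∫⁻ x in ({0}ᶜ : Set E), g x ∂μ := by rw [restrict_compl_singleton]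
    _ = ∫⁻ x : ({0}ᶜ : Set E), g x ∂(μ.comap (↑)) := by
        rw [lintegral_subtype_comap (measurableSet_singleton _).compl]
    _ = ∫⁻ x : ({0}ᶜ : Set E), (fun y : sphere (0 : E) 1 × Set.Ioi (0 : ℝ) =>
          g ((y.2 : ℝ) • (y.1 : E))) (homeomorphUnitSphereProd E x) ∂(μ.comap (↑)) := by
        refine lintegral_congr fun x => ?_
        have hx : ‖(x : E)‖ ≠ 0 := norm_ne_zero_iff.2 x.2
        simp [smul_smul, hx]
    _ = ∫⁻ y, g ((y.2 : ℝ) • (y.1 : E))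
          ∂(μ.toSphere.prod (Measure.volumeIoiPow (Module.finrank ℝ E - 1))) :=
        μ.measurePreserving_homeomorphUnitSphereProd.lintegral_comp hsm
    _ = ∫⁻ r : Set.Ioi (0 : ℝ), (∫⁻ ξ : sphere (0 : E) 1, g ((r : ℝ) • (ξ : E)) ∂μ.toSphere)
          ∂(Measure.volumeIoiPow (Module.finrank ℝ E - 1)) :=
        lintegral_prod_symm' _ hsm
    _ = _ := by
        rw [Measure.volumeIoiPow, lintegral_withDensity_eq_lintegral_mul _ (by fun_prop)
          (g := fun r : Set.Ioi (0 : ℝ) =>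
            ∫⁻ ξ : sphere (0 : E) 1, g ((r : ℝ) • (ξ : E)) ∂μ.toSphere)
          (hin.comp measurable_subtype_coe)]
        exact lintegral_subtype_comap measurableSet_Ioi
          (fun r : ℝ => ENNReal.ofReal (r ^ (Module.finrank ℝ E - 1)) *
            ∫⁻ ξ : sphere (0 : E) 1, g (r • (ξ : E)) ∂μ.toSphere)

/-- The integral of a radial function times a function homogeneous of degree `m` is a radial
integral times a spherical integral. -/
theorem lintegral_radial_mul_homogeneous (μ : Measure E) [μ.IsAddHaarMeasure]
    {G : E → ℝ≥0∞} (hG : Measurable G) {h : ℝ → ℝ≥0∞} (hh : Measurable h) (m : ℕ)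
    (hom : ∀ (r : ℝ) (x : E), 0 < r → G (r • x) = ENNReal.ofReal (r ^ m) * G x) :
    ∫⁻ x, h ‖x‖ * G x ∂μ =
      (∫⁻ r in Set.Ioi (0 : ℝ), ENNReal.ofReal (r ^ (Module.finrank ℝ E - 1 + m)) * h r) *
        ∫⁻ ξ : sphere (0 : E) 1, G ξ ∂μ.toSphere := by
  rw [lintegral_eq_lintegral_polar μ (by fun_prop), ← lintegral_mul_const _ (by fun_prop)]
  refine setLIntegral_congr_fun measurableSet_Ioi fun r hr => ?_
  have hr : 0 < r := hr
  have h1 : ∀ ξ : sphere (0 : E) 1, h ‖r • (ξ : E)‖ * G (r • (ξ : E)) =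
      (h r * ENNReal.ofReal (r ^ m)) * G ξ := fun ξ => by
    rw [hom r _ hr, norm_smul]
    simp [abs_of_pos hr, mul_assoc]
  simp_rw [h1]
  rw [lintegral_const_mul _ (by fun_prop), pow_add, ENNReal.ofReal_mul (by positivity)]
  ring

/-- The surface measure inherits the invariance of Lebesgue measure under a linear isometry. -/
theorem lintegral_toSphere_comp_isometry (μ : Measure E) [μ.IsAddHaarMeasure]
    (U : E ≃ₗᵢ[ℝ] E) (hU : MeasurePreserving U μ μ) {g : E → ℝ≥0∞} (hg : Measurable g) :
    ∫⁻ ξ : sphere (0 : E) 1, g (U ξ) ∂μ.toSphere = ∫⁻ ξ : sphere (0 : E) 1, g ξ ∂μ.toSphere := by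
  -- Extend `g` to a function that is constant on rays, and cut it off by a radial factor.
  set h : ℝ → ℝ≥0∞ := (Set.Ioo (0 : ℝ) 1).indicator 1 with hh
  have hm : Measurable h := measurable_one.indicator measurableSet_Ioo
  have key : ∀ g : E → ℝ≥0∞, Measurable g → ∫⁻ x, h ‖x‖ * g (‖x‖⁻¹ • x) ∂μ =
      (∫⁻ r in Set.Ioi (0 : ℝ), ENNReal.ofReal (r ^ (Module.finrank ℝ E - 1)) * h r) *
        ∫⁻ ξ : sphere (0 : E) 1, g ξ ∂μ.toSphere := fun g hg => by
    have := lintegral_radial_mul_homogeneous μ (G := fun x => g (‖x‖⁻¹ • x)) (by fun_prop) hm 0 ?_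
    · simpa using this
    · intro r x hr
      simp only [pow_zero, ENNReal.ofReal_one, one_mul, norm_smul, Real.norm_eq_abs,
        abs_of_pos hr, smul_smul]
      congr 2
      field_simp
  have hc : (∫⁻ r in Set.Ioi (0 : ℝ), ENNReal.ofReal (r ^ (Module.finrank ℝ E - 1)) * h r) ≠ 0 := by
    intro h0
    rw [lintegral_eq_zero_iff (by fun_prop)] at h0
    have : ∀ᵐ r ∂(volume.restrict (Set.Ioi (0 : ℝ))), r ∉ Set.Ioo (0 : ℝ) 1 := by
      filter_upwards [h0] with r hr hr1
      simp only [hh, Set.indicator_of_mem hr1, Pi.one_apply, mul_one, Pi.zero_apply,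
        ENNReal.ofReal_eq_zero] at hr
      exact absurd hr (not_le.2 (pow_pos hr1.1 _))
    rw [ae_iff] at this
    simp only [not_not, Set.ofPred_mem_eq] at this
    rw [Measure.restrict_apply measurableSet_Ioo,
      Set.inter_eq_left.2 Set.Ioo_subset_Ioi_self] at this
    simp at this
  have hc' : (∫⁻ r in Set.Ioi (0 : ℝ),
      ENNReal.ofReal (r ^ (Module.finrank ℝ E - 1)) * h r) ≠ ∞ := by
    refine ne_top_of_le_ne_top (b := ∫⁻ r in Set.Ioi (0 : ℝ), h r) ?_ ?_
    · rw [hh, lintegral_indicator_one measurableSet_Ioo, Measure.restrict_apply measurableSet_Ioo,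
        Set.inter_eq_left.2 Set.Ioo_subset_Ioi_self]
      simp
    · refine setLIntegral_mono hm fun r hr => ?_
      by_cases hr1 : r ∈ Set.Ioo (0 : ℝ) 1
      · simp only [hh, Set.indicator_of_mem hr1, Pi.one_apply, mul_one]
        exact ENNReal.ofReal_le_one.2 (pow_le_one₀ hr1.1.le hr1.2.le)
      · simp [hh, Set.indicator_of_notMem hr1]
  have h1 := key (fun x => g (U x)) (hg.comp U.continuous.measurable)
  have h2 := key g hg
  rw [← hU.lintegral_comp (f := fun x => h ‖x‖ * g (‖x‖⁻¹ • x)) (by fun_prop)] at h2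
  simp only [LinearIsometryEquiv.norm_map, ← map_smul] at h2
  exact (ENNReal.mul_right_inj hc hc').1 (h1.symm.trans h2)

end Polar

/-! ### Unitary maps of `ℂⁿ` -/

/-- A complex linear isometry, viewed as a real one. -/
noncomputable def realIsometry {n : ℕ} (U : Cn n ≃ₗᵢ[ℂ] Cn n) : Cn n ≃ₗᵢ[ℝ] Cn n where
  toLinearEquiv := U.toLinearEquiv.restrictScalars ℝ
  norm_map' := U.norm_map

/-- Multiplication by a complex number of modulus one, as a real isometry. -/
noncomputable def circleIsometry {n : ℕ} (w : ℂ) (hw : ‖w‖ = 1) : Cn n ≃ₗᵢ[ℝ] Cn n where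
  toLinearEquiv := (LinearEquiv.smulOfNeZero ℂ (Cn n) w (by
    rintro rfl; simp at hw)).restrictScalars ℝ
  norm_map' z := by
    change ‖w • z‖ = ‖z‖
    rw [norm_smul, hw, one_mul]

theorem finrank_real_Cn (n : ℕ) : Module.finrank ℝ (Cn n) = 2 * n := by
  rw [← Module.finrank_mul_finrank ℝ ℂ (Cn n), Complex.finrank_real_complex, finrank_euclideanSpace,
    Fintype.card_fin]

theorem lintegral_volume_rotate {n : ℕ} {w : ℂ} (hw : ‖w‖ = 1) {g : Cn n → ℝ≥0∞}
    (hg : Measurable g) : ∫⁻ z, g (w • z) = ∫⁻ z, g z :=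
  (circleIsometry w hw).measurePreserving.lintegral_comp hg

theorem lintegral_toSphere_rotate {n : ℕ} [NeZero n] {w : ℂ} (hw : ‖w‖ = 1) {g : Cn n → ℝ≥0∞}
    (hg : Measurable g) :
    ∫⁻ ξ : sphere (0 : Cn n) 1, g (w • (ξ : Cn n)) ∂(volume : Measure (Cn n)).toSphere =
      ∫⁻ ξ : sphere (0 : Cn n) 1, g ξ ∂(volume : Measure (Cn n)).toSphere :=
  lintegral_toSphere_comp_isometry volume (circleIsometry w hw)
    (circleIsometry w hw).measurePreserving hg

/-- Up to a rotation, pairing with `b` is `‖b‖` times a coordinate. -/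
theorem exists_unitary_norm_inner {n : ℕ} (i : Fin n) (b : Cn n) :
    ∃ U : Cn n ≃ₗᵢ[ℂ] Cn n, ∀ z : Cn n, ‖inner ℂ b z‖ = ‖b‖ * ‖U z i‖ := by
  by_cases hb : b = 0
  · exact ⟨LinearIsometryEquiv.refl ℂ _, by simp [hb]⟩
  have hb' : ‖b‖ ≠ 0 := norm_ne_zero_iff.2 hb
  let e : Cn n := ((‖b‖⁻¹ : ℝ) : ℂ) • b
  have he : ‖e‖ = 1 := by simp [e, norm_smul, hb']
  obtain ⟨B, hB⟩ := Orthonormal.exists_orthonormalBasis_extension_of_card_eq (𝕜 := ℂ)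
    (E := Cn n) (ι := Fin n) (by simp) (v := fun _ => e) (s := {i}) (by
      constructor
      · intro j; simpa using he
      · intro j k hjk; exact absurd (Subsingleton.elim j k) hjk)
  refine ⟨B.repr, fun z => ?_⟩
  rw [B.repr_apply_apply, hB i rfl]
  simp only [e, inner_smul_left, norm_mul]
  simp [hb']

/-! ### Parseval's identity and averaging over rotations -/

/-- Parseval's identity for an absolutely convergent Fourier series with the frequencies `d k`. -/
theorem lintegral_norm_sq_fourier_sum {d : ℕ → ℕ} (hd : Function.Injective d) {c : ℕ → ℂ}
    (hc : Summable fun k => ‖c k‖) {G : AddCircle (1 : ℝ) → ℂ}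
    (hG : ∀ t, HasSum (fun k => c k * fourier (d k : ℤ) t) (G t)) :
    ∫⁻ t, ENNReal.ofReal (‖G t‖ ^ 2) ∂AddCircle.haarAddCircle =
      ∑' k, ENNReal.ofReal (‖c k‖ ^ 2) := by
  have hsum : Summable fun k => c k • (fourier (d k : ℤ) : C(AddCircle (1 : ℝ), ℂ)) := by
    refine Summable.of_norm ?_
    simpa [norm_smul, fourier_norm] using hc
  obtain ⟨F, hF⟩ := hsum
  have hFG : ∀ t, F t = G t := fun t => by
    have h1 := (ContinuousMap.evalCLM ℂ t).hasSum hF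
    exact h1.unique (by simpa using hG t)
  have h2 : HasSum (fun k => c k • (fourierLp (T := (1 : ℝ)) 2 (d k : ℤ)))
      (ContinuousMap.toLp 2 AddCircle.haarAddCircle ℂ F) := by
    simpa using (ContinuousMap.toLp (E := ℂ) 2 (AddCircle.haarAddCircle (T := (1 : ℝ))) ℂ).hasSum hF
  have hor : Orthonormal ℂ fun k : ℕ => fourierLp (T := (1 : ℝ)) 2 (d k : ℤ) :=
    orthonormal_fourier.comp _ fun a b hab => hd (by simpa using hab)
  have h3 : HasSum (fun k => ‖c k‖ ^ 2)
      (‖ContinuousMap.toLp (E := ℂ) 2 (AddCircle.haarAddCircle (T := (1 : ℝ))) ℂ F‖ ^ 2) := by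
    have h4 : Tendsto _ atTop _ := ((continuous_norm.pow 2).tendsto _).comp h2
    refine h4.congr fun s => ?_
    change ‖∑ k ∈ s, c k • fourierLp (T := (1 : ℝ)) 2 (d k : ℤ)‖ ^ 2 = ∑ k ∈ s, ‖c k‖ ^ 2
    have h5 := hor.inner_sum c c s
    rw [inner_self_eq_norm_sq_to_K] at h5
    simp only [RCLike.conj_mul] at h5
    exact_mod_cast h5
  have h6 : ‖ContinuousMap.toLp (E := ℂ) 2 (AddCircle.haarAddCircle (T := (1 : ℝ))) ℂ F‖ ^ 2 =
      ∫ t, ‖F t‖ ^ 2 ∂AddCircle.haarAddCircle := by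
    have h7 := ContinuousMap.inner_toLp (𝕜 := ℂ) (AddCircle.haarAddCircle (T := (1 : ℝ))) F F
    rw [inner_self_eq_norm_sq_to_K] at h7
    simp only [RCLike.mul_conj] at h7
    have h8 : ∫ t, ((‖F t‖ ^ 2 : ℝ) : ℂ) ∂(AddCircle.haarAddCircle (T := (1 : ℝ))) =
        ((∫ t, ‖F t‖ ^ 2 ∂(AddCircle.haarAddCircle (T := (1 : ℝ))) : ℝ) : ℂ) := integral_ofReal
    push_cast at h8
    exact Complex.ofReal_injective ((by simp : _ = _).trans (h7.trans h8))
  have hint : Integrable (fun t => ‖F t‖ ^ 2) (AddCircle.haarAddCircle (T := (1 : ℝ))) :=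
    (by fun_prop : Continuous fun t => ‖F t‖ ^ 2).integrable_of_hasCompactSupport
      (HasCompactSupport.of_compactSpace _)
  simp_rw [← hFG]
  rw [← ofReal_integral_eq_lintegral_ofReal hint (ae_of_all _ fun t => by positivity), ← h6,
    ← h3.tsum_eq, ENNReal.ofReal_tsum_of_nonneg (fun k => by positivity) h3.summable]

/-- Homogeneous functions of different degrees are orthogonal for every rotation-invariant
measure: average over `z ↦ w • z`, `|w| = 1`, and use Parseval's identity on the circle. -/
theorem lintegral_norm_sq_sum_homogeneous {n : ℕ} {ν : Measure (Cn n)} [SFinite ν]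
    (hν : ∀ w : ℂ, ‖w‖ = 1 → ∀ g : Cn n → ℝ≥0∞, Measurable g → ∫⁻ z, g (w • z) ∂ν = ∫⁻ z, g z ∂ν)
    {d : ℕ → ℕ} (hd : Function.Injective d) {F : ℕ → Cn n → ℂ} (hF : ∀ k, Measurable (F k))
    (hom : ∀ (k : ℕ) (w : ℂ) (z : Cn n), F k (w • z) = w ^ d k * F k z)
    {S : Set (Cn n)} (hS : ∀ᵐ z ∂ν, z ∈ S) (hSw : ∀ w : ℂ, ‖w‖ = 1 → ∀ z ∈ S, w • z ∈ S)
    {G : Cn n → ℂ} (hG : Measurable G) (hFG : ∀ z ∈ S, HasSum (fun k => F k z) (G z))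
    {h : ℝ → ℝ≥0∞} (hh : Measurable h) :
    ∫⁻ z, h ‖z‖ * ENNReal.ofReal (‖G z‖ ^ 2) ∂ν =
      ∑' k, ∫⁻ z, h ‖z‖ * ENNReal.ofReal (‖F k z‖ ^ 2) ∂ν := by
  let w : AddCircle (1 : ℝ) → ℂ := fun t => fourier (1 : ℤ) t
  have hwc : Continuous w := (fourier (1 : ℤ)).continuous
  have hw : ∀ t, ‖w t‖ = 1 := fun t => by simp [w, fourier_apply, Circle.norm_coe]
  have hwp : ∀ (k : ℕ) t, w t ^ k = fourier (k : ℤ) t := fun k t => by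
    simp only [w, fourier_apply, one_smul]
    rw [natCast_zsmul, AddCircle.toCircle_nsmul]
    simp
  calc ∫⁻ z, h ‖z‖ * ENNReal.ofReal (‖G z‖ ^ 2) ∂ν
      = ∫⁻ t : AddCircle (1 : ℝ), ∫⁻ z, h ‖z‖ * ENNReal.ofReal (‖G (w t • z)‖ ^ 2) ∂ν
          ∂AddCircle.haarAddCircle := by
        have h1 : ∀ t, ∫⁻ z, h ‖z‖ * ENNReal.ofReal (‖G (w t • z)‖ ^ 2) ∂ν =
            ∫⁻ z, h ‖z‖ * ENNReal.ofReal (‖G z‖ ^ 2) ∂ν := fun t => by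
          have := hν (w t) (hw t) (fun z => h ‖z‖ * ENNReal.ofReal (‖G z‖ ^ 2)) (by fun_prop)
          simpa [norm_smul, hw] using this
        simp_rw [h1]
        simp
    _ = ∫⁻ z, ∫⁻ t : AddCircle (1 : ℝ), h ‖z‖ * ENNReal.ofReal (‖G (w t • z)‖ ^ 2)
          ∂AddCircle.haarAddCircle ∂ν := by
        refine lintegral_lintegral_swap (Measurable.aemeasurable ?_)
        change Measurable fun y : AddCircle (1 : ℝ) × Cn n =>
          h ‖y.2‖ * ENNReal.ofReal (‖G (w y.1 • y.2)‖ ^ 2)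
        have : Measurable w := hwc.measurable
        fun_prop
    _ = ∫⁻ z, ∑' k, h ‖z‖ * ENNReal.ofReal (‖F k z‖ ^ 2) ∂ν := by
        refine lintegral_congr_ae ?_
        filter_upwards [hS] with z hz
        have : Measurable w := hwc.measurable
        rw [lintegral_const_mul _ (by fun_prop), ENNReal.tsum_mul_left,
          lintegral_norm_sq_fourier_sum hd (hFG z hz).summable.norm]
        intro t
        have := hFG _ (hSw (w t) (hw t) z hz)
        simp_rw [hom, hwp] at this
        simpa [mul_comm] using this
    _ = _ := lintegral_tsum fun k => (by have := hF k; fun_prop)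

/-! ### Moments of the surface measure -/

/-- Lebesgue measure on `ℂⁿ` is a multiple of the product measure. The constant cancels in the
moments below, so its value `1` is not needed. -/
theorem exists_lintegral_eq_mul_lintegral_pi (n : ℕ) :
    ∃ c : ℝ≥0∞, ∀ g : Cn n → ℝ≥0∞, Measurable g →
      ∫⁻ z, g z = c * ∫⁻ x : Fin n → ℂ, g (WithLp.toLp 2 x) := by
  let L := (PiLp.continuousLinearEquiv 2 ℝ (fun _ : Fin n => ℂ)).symm
  have := L.isAddHaarMeasure_map (volume : Measure (Fin n → ℂ))
  refine ⟨(volume : Measure (Cn n)).addHaarScalarFactor (Measure.map L volume), fun g hg => ?_⟩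
  conv_lhs => rw [Measure.isAddLeftInvariant_eq_smul (volume : Measure (Cn n))
    (Measure.map L volume)]
  rw [lintegral_smul_measure, lintegral_map hg L.continuous.measurable]
  rfl

/-- The Gaussian integral of `|z_i|^(2k)` over `ℂⁿ` is `k!` times the one for `k = 0`. -/
theorem exists_lintegral_gaussian_coord (n : ℕ) (i : Fin n) :
    ∃ c : ℝ≥0∞, ∀ k : ℕ, ∫⁻ z : Cn n, ENNReal.ofReal (Real.exp (-‖z‖ ^ 2)) *
      ENNReal.ofReal (‖z i‖ ^ (2 * k)) = c * (k.factorial : ℝ≥0∞) := by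
  obtain ⟨c, hc⟩ := exists_lintegral_eq_mul_lintegral_pi n
  refine ⟨c * ENNReal.ofReal (Real.pi ^ n), fun k => ?_⟩
  have hone : ∀ m : ℕ, ∫ w : ℂ, ‖w‖ ^ (2 * m) * Real.exp (-‖w‖ ^ 2) = Real.pi * m.factorial := by
    intro m
    have := Complex.integral_rpow_mul_exp_neg_rpow (p := 2) (q := (2 * m : ℕ)) (by norm_num)
      (by linarith [(Nat.cast_nonneg (2 * m) : (0 : ℝ) ≤ _)])
    rw [show (((2 * m : ℕ) : ℝ) + 2) / 2 = m + 1 by push_cast; ring, Real.Gamma_nat_eq_factorial]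
      at this
    simp only [Real.rpow_natCast, Real.rpow_two] at this
    rw [this]; ring
  rw [hc _ (by fun_prop)]
  have hF : ∀ x : Fin n → ℂ, ENNReal.ofReal (Real.exp (-‖WithLp.toLp 2 x‖ ^ 2)) *
      ENNReal.ofReal (‖x i‖ ^ (2 * k)) = ENNReal.ofReal (∏ j, (if j = i then
        ‖x j‖ ^ (2 * k) * Real.exp (-‖x j‖ ^ 2) else
        ‖x j‖ ^ (2 * 0) * Real.exp (-‖x j‖ ^ 2))) := fun x => by
    rw [← ENNReal.ofReal_mul (Real.exp_nonneg _)]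
    congr 1
    rw [EuclideanSpace.norm_sq_eq, ← Finset.sum_neg_distrib, Real.exp_sum,
      ← Finset.mul_prod_erase _ _ (Finset.mem_univ i),
      ← Finset.mul_prod_erase Finset.univ (fun j => if j = i then _ else _) (Finset.mem_univ i)]
    simp only [if_true]
    rw [Finset.prod_congr rfl fun j hj => if_neg (Finset.ne_of_mem_erase hj)]
    simp
    ring
  have hI := integral_fintype_prod_volume_eq_prod (𝕜 := ℝ) (fun (j : Fin n) (w : ℂ) =>
    if j = i then ‖w‖ ^ (2 * k) * Real.exp (-‖w‖ ^ 2) else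
        ‖w‖ ^ (2 * 0) * Real.exp (-‖w‖ ^ 2))
  have hV : ∏ j : Fin n, ∫ w : ℂ, (if j = i then ‖w‖ ^ (2 * k) * Real.exp (-‖w‖ ^ 2) else
        ‖w‖ ^ (2 * 0) * Real.exp (-‖w‖ ^ 2)) = Real.pi ^ n * k.factorial := by
    have : ∀ j : Fin n, ∫ w : ℂ, (if j = i then ‖w‖ ^ (2 * k) * Real.exp (-‖w‖ ^ 2) else
        ‖w‖ ^ (2 * 0) * Real.exp (-‖w‖ ^ 2)) =
        Real.pi * (if j = i then (k.factorial : ℝ) else 1) := fun j => by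
      split_ifs
      · exact hone k
      · simpa using hone 0
    simp_rw [this]
    rw [Finset.prod_mul_distrib]
    simp
  rw [hV] at hI
  simp_rw [hF]
  rw [← ofReal_integral_eq_lintegral_ofReal, hI, ENNReal.ofReal_mul (by positivity),
    ENNReal.ofReal_natCast, mul_assoc]
  · exact Integrable.of_integral_ne_zero (by rw [hI]; positivity)
  · refine ae_of_all _ fun x => Finset.prod_nonneg fun j _ => ?_
    split_ifs <;> positivity

theorem lintegral_rpow_gaussian (m : ℕ) :
    ∫⁻ r in Set.Ioi (0 : ℝ), ENNReal.ofReal (r ^ (2 * m + 1)) *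
      ENNReal.ofReal (Real.exp (-r ^ 2)) = ENNReal.ofReal (m.factorial / 2) := by
  have := integral_rpow_mul_exp_neg_rpow (p := 2) (q := (2 * m + 1 : ℕ)) (by norm_num)
      (by linarith [(Nat.cast_nonneg (2 * m + 1) : (0 : ℝ) ≤ _)])
  rw [show (((2 * m + 1 : ℕ) : ℝ) + 1) / 2 = m + 1 by push_cast; ring,
    Real.Gamma_nat_eq_factorial] at this
  simp only [Real.rpow_natCast, Real.rpow_two] at this
  rw [show (m.factorial : ℝ) / 2 = 1 / 2 * m.factorial by ring, ← this,
    ofReal_integral_eq_lintegral_ofReal]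
  · refine setLIntegral_congr_fun measurableSet_Ioi fun r hr => ?_
    rw [ENNReal.ofReal_mul (pow_nonneg (le_of_lt hr) _)]
  · exact Integrable.of_integral_ne_zero (by rw [this]; positivity)
  · filter_upwards [ae_restrict_mem measurableSet_Ioi] with r hr
    exact mul_nonneg (pow_nonneg (le_of_lt hr) _) (Real.exp_nonneg _)

/-- The moments of the surface measure: the normalized integral of `|⟨ξ, b⟩|^(2k)` is
`|b|^(2k) / binom(n-1+k, n-1)`. Compare a Gaussian integral over `ℂⁿ` in Cartesian and in polar
coordinates. -/
theorem choose_mul_lintegral_norm_inner_pow {N : ℕ} (b : Cn (N + 1)) (k : ℕ) :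
    ((k + N).choose N : ℝ≥0∞) *
      ∫⁻ ξ : sphere (0 : Cn (N + 1)) 1, ENNReal.ofReal (‖inner ℂ b (ξ : Cn (N + 1))‖ ^ (2 * k))
        ∂(volume : Measure (Cn (N + 1))).toSphere =
      ENNReal.ofReal (‖b‖ ^ (2 * k)) * (volume : Measure (Cn (N + 1))).toSphere Set.univ := by
  obtain ⟨U, hU⟩ := exists_unitary_norm_inner 0 b
  obtain ⟨c, hc⟩ := exists_lintegral_gaussian_coord (N + 1) 0
  -- Both sides of the polar formula for the Gaussian integral of the `2j`-th power.
  have key : ∀ j : ℕ, ENNReal.ofReal (‖b‖ ^ (2 * j)) * (c * (j.factorial : ℝ≥0∞)) =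
      ENNReal.ofReal ((N + j).factorial / 2) *
      ∫⁻ ξ : sphere (0 : Cn (N + 1)) 1, ENNReal.ofReal (‖inner ℂ b (ξ : Cn (N + 1))‖ ^ (2 * j))
        ∂(volume : Measure (Cn (N + 1))).toSphere := fun j => by
    have h1 := lintegral_radial_mul_homogeneous (volume : Measure (Cn (N + 1)))
      (G := fun z => ENNReal.ofReal (‖inner ℂ b z‖ ^ (2 * j))) (by fun_prop)
      (h := fun r => ENNReal.ofReal (Real.exp (-r ^ 2))) (by fun_prop) (2 * j) (by
        intro r z hr
        rw [← ENNReal.ofReal_mul (by positivity), ← mul_pow, ← Complex.coe_smul, inner_smul_right,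
          norm_mul, Complex.norm_real, Real.norm_of_nonneg hr.le])
    rw [finrank_real_Cn, show 2 * (N + 1) - 1 + 2 * j = 2 * (N + j) + 1 by omega,
      lintegral_rpow_gaussian] at h1
    have hUm : Measurable fun z : Cn (N + 1) => ENNReal.ofReal (Real.exp (-‖z‖ ^ 2)) *
      ENNReal.ofReal (‖z 0‖ ^ (2 * j)) := by fun_prop
    replace hUm := hUm.comp (realIsometry U).continuous.measurable
    simp only [Function.comp_def] at hUm
    rw [← h1, ← hc j, ← (realIsometry U).measurePreserving.lintegral_comp (by fun_prop),
      ← lintegral_const_mul _ hUm]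
    refine lintegral_congr fun z => ?_
    have h2 : realIsometry U z = U z := rfl
    rw [h2, U.norm_map, hU z, mul_pow, ENNReal.ofReal_mul (by positivity)]
    ring
  have k0 := key 0
  simp only [mul_zero, pow_zero, ENNReal.ofReal_one, Nat.factorial_zero, Nat.cast_one, mul_one,
    one_mul, add_zero, lintegral_const] at k0
  have kk := key k
  rw [k0] at kk
  set T := ∫⁻ ξ : sphere (0 : Cn (N + 1)) 1,
    ENNReal.ofReal (‖inner ℂ b (ξ : Cn (N + 1))‖ ^ (2 * k))
      ∂(volume : Measure (Cn (N + 1))).toSphere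
  set τ := (volume : Measure (Cn (N + 1))).toSphere Set.univ
  have hch : ENNReal.ofReal ((N + k).factorial / 2) = ((k + N).choose N : ℝ≥0∞) *
      (ENNReal.ofReal (N.factorial / 2) * k.factorial) := by
    rw [← ENNReal.ofReal_natCast, ← ENNReal.ofReal_natCast (k.factorial),
      ← ENNReal.ofReal_mul (by positivity), ← ENNReal.ofReal_mul (by positivity)]
    congr 1
    have : (((k + N).choose N * N.factorial * k.factorial : ℕ) : ℝ) = ((k + N).factorial : ℕ) := by
      congr 1
      have := Nat.choose_mul_factorial_mul_factorial (Nat.le_add_left N k)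
      rwa [Nat.add_sub_cancel] at this
    push_cast at this
    rw [add_comm N k, ← this]
    ring
  rw [hch] at kk
  have h0 : ENNReal.ofReal (N.factorial / 2) * (k.factorial : ℝ≥0∞) ≠ 0 := by
    refine mul_ne_zero ?_ (by exact_mod_cast k.factorial_ne_zero)
    rw [Ne, ENNReal.ofReal_eq_zero, not_le]
    positivity
  have ht : ENNReal.ofReal (N.factorial / 2) * (k.factorial : ℝ≥0∞) ≠ ∞ :=
    ENNReal.mul_ne_top ENNReal.ofReal_ne_top (ENNReal.natCast_ne_top _)
  refine (ENNReal.mul_right_inj h0 ht).1 ?_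
  calc _ = ((k + N).choose N : ℝ≥0∞) *
      (ENNReal.ofReal (N.factorial / 2) * k.factorial) * T := by ring
    _ = _ := kk.symm
    _ = _ := by ring

/-! ### The invariant Poisson kernel -/

/-- The integral over the sphere of `|1 - ⟨ξ, b⟩|^(-2n)` is `(1 - |b|²)^(-n)` times the total
mass: expand `(1 - ⟨ξ, b⟩)^(-n)` in powers of `⟨ξ, b⟩`, which are orthogonal. -/
theorem lintegral_poisson_kernel {N : ℕ} {b : Cn (N + 1)} (hb : ‖b‖ < 1) :
    ∫⁻ ξ : sphere (0 : Cn (N + 1)) 1,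
      ENNReal.ofReal (‖1 / (1 - inner ℂ b (ξ : Cn (N + 1))) ^ (N + 1)‖ ^ 2)
        ∂(volume : Measure (Cn (N + 1))).toSphere =
      ENNReal.ofReal (1 / (1 - ‖b‖ ^ 2) ^ (N + 1)) *
        (volume : Measure (Cn (N + 1))).toSphere Set.univ := by
  set τ := (volume : Measure (Cn (N + 1))).toSphere
  have hval : Measurable (Subtype.val : sphere (0 : Cn (N + 1)) 1 → Cn (N + 1)) :=
    measurable_subtype_coe
  have hlt : ∀ z ∈ closedBall (0 : Cn (N + 1)) 1, ‖inner ℂ b z‖ < 1 := fun z hz => by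
    rw [mem_closedBall_zero_iff] at hz
    calc ‖inner ℂ b z‖ ≤ ‖b‖ * ‖z‖ := norm_inner_le_norm b z
      _ ≤ ‖b‖ * 1 := by gcongr
      _ < 1 := by simpa using hb
  have key := lintegral_norm_sq_sum_homogeneous (ν := τ.map Subtype.val)
    (fun w hw g hg => by
      rw [lintegral_map (by fun_prop) hval, lintegral_map hg hval]
      exact lintegral_toSphere_rotate hw hg)
    (d := fun k => k) Function.injective_id
    (F := fun k z => ((k + N).choose N : ℂ) * inner ℂ b z ^ k) (fun k => by fun_prop)
    (fun k w z => by rw [inner_smul_right]; ring)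
    (S := closedBall 0 1)
    (by
      refine (ae_map_iff hval.aemeasurable measurableSet_closedBall).2 ?_
      exact ae_of_all _ fun ξ => sphere_subset_closedBall ξ.2)
    (fun w hw z hz => by simpa [norm_smul, hw] using hz)
    (G := fun z => 1 / (1 - inner ℂ b z) ^ (N + 1)) (by fun_prop)
    (fun z hz => hasSum_choose_mul_geometric_of_norm_lt_one N (hlt z hz))
    (h := fun _ => 1) measurable_const
  simp only [one_mul] at key
  rw [lintegral_map (by fun_prop) hval] at key
  rw [key]
  have hterm : ∀ k : ℕ, ∫⁻ z, ENNReal.ofReal (‖((k + N).choose N : ℂ) * inner ℂ b z ^ k‖ ^ 2)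
      ∂(τ.map Subtype.val) =
      ENNReal.ofReal ((k + N).choose N * (‖b‖ ^ 2) ^ k) * τ Set.univ := fun k => by
    rw [lintegral_map (by fun_prop) hval, ENNReal.ofReal_mul (by positivity), mul_assoc,
      ← pow_mul, ← choose_mul_lintegral_norm_inner_pow, ENNReal.ofReal_natCast,
      ← mul_assoc, ← lintegral_const_mul _ (by fun_prop)]
    refine lintegral_congr fun ξ => ?_
    rw [norm_mul, mul_pow, ENNReal.ofReal_mul (by positivity), norm_pow, ← pow_mul, mul_comm k 2,
      Complex.norm_natCast, ENNReal.ofReal_pow (by positivity), ENNReal.ofReal_natCast, sq]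
  simp_rw [hterm]
  rw [ENNReal.tsum_mul_right]
  congr 1
  have hb2 : ‖‖b‖ ^ 2‖ < 1 := by
    rw [Real.norm_of_nonneg (by positivity)]
    exact pow_lt_one₀ (norm_nonneg _) hb two_ne_zero
  have hs := hasSum_choose_mul_geometric_of_norm_lt_one N hb2
  rw [← ENNReal.ofReal_tsum_of_nonneg (fun k => by positivity) hs.summable, hs.tsum_eq]

/-- For `p ≤ n` the sphere averages of `((1 - |a|²) / |1 - ⟨z, a⟩|²)^p` are at most `1`: for
`p = n` this follows from the integral of the Poisson kernel at the point `r • a`, and the rest is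
Hölder's inequality. -/
theorem lintegral_kernel_rpow_le {N : ℕ} {p : ℝ} (hp : 0 < p) (hpn : p ≤ (N + 1 : ℕ))
    {a : Cn (N + 1)} (ha : ‖a‖ < 1) {r : ℝ} (hr0 : 0 ≤ r) (hr1 : r < 1) :
    ∫⁻ ξ : sphere (0 : Cn (N + 1)) 1, ENNReal.ofReal
      (((1 - ‖a‖ ^ 2) / ‖1 - inner ℂ a (r • (ξ : Cn (N + 1)))‖ ^ 2) ^ p)
        ∂(volume : Measure (Cn (N + 1))).toSphere ≤
      (volume : Measure (Cn (N + 1))).toSphere Set.univ := by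
  set τ := (volume : Measure (Cn (N + 1))).toSphere
  -- The integrand is `X ^ θ`, where the integral of `X` is at most the total mass.
  set θ : ℝ := p / (N + 1 : ℕ) with hθ
  have hN : (0 : ℝ) < (N + 1 : ℕ) := by positivity
  have hθ0 : 0 ≤ θ := by positivity
  have hθ1 : θ ≤ 1 := (div_le_one hN).2 hpn
  have ha2 : ‖a‖ ^ 2 < 1 := pow_lt_one₀ (norm_nonneg _) ha two_ne_zero
  have hra : ‖r • a‖ ≤ ‖a‖ := by
    rw [norm_smul, Real.norm_of_nonneg hr0]
    exact mul_le_of_le_one_left (norm_nonneg _) hr1.le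
  set X : sphere (0 : Cn (N + 1)) 1 → ℝ≥0∞ := fun ξ => ENNReal.ofReal ((1 - ‖a‖ ^ 2) ^ (N + 1)) *
    ENNReal.ofReal (‖1 / (1 - inner ℂ (r • a) (ξ : Cn (N + 1))) ^ (N + 1)‖ ^ 2) with hX
  have hXm : Measurable X := by fun_prop
  have hXint : ∫⁻ ξ, X ξ ∂τ ≤ τ Set.univ := by
    rw [hX, lintegral_const_mul _ (by fun_prop), lintegral_poisson_kernel (hra.trans_lt ha),
      ← mul_assoc, ← ENNReal.ofReal_mul (by have := sub_nonneg.2 ha2.le; positivity)]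
    refine mul_le_of_le_one_left' (ENNReal.ofReal_le_one.2 ?_)
    have h1 : 1 - ‖a‖ ^ 2 ≤ 1 - ‖r • a‖ ^ 2 := by gcongr
    rw [mul_one_div]
    exact div_le_one_of_le₀ (pow_le_pow_left₀ (by linarith) h1 _)
      (pow_nonneg (by linarith) _)
  have hXp : ∀ ξ : sphere (0 : Cn (N + 1)) 1, ENNReal.ofReal
      (((1 - ‖a‖ ^ 2) / ‖1 - inner ℂ a (r • (ξ : Cn (N + 1)))‖ ^ 2) ^ p) =
      X ξ ^ θ * 1 ^ (1 - θ) := fun ξ => by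
    have hin : inner ℂ (r • a) (ξ : Cn (N + 1)) = inner ℂ a (r • (ξ : Cn (N + 1))) := by
      rw [← Complex.coe_smul, ← Complex.coe_smul, inner_smul_left, inner_smul_right,
        Complex.conj_ofReal]
    have h0 : 0 ≤ (1 - ‖a‖ ^ 2) / ‖1 - inner ℂ a (r • (ξ : Cn (N + 1)))‖ ^ 2 :=
      div_nonneg (by linarith) (by positivity)
    rw [ENNReal.one_rpow, mul_one, hX]
    dsimp only
    rw [hin, ← ENNReal.ofReal_mul (pow_nonneg (by linarith) _), one_div, norm_inv, norm_pow,
      inv_pow, ← pow_mul, mul_comm (N + 1) 2, pow_mul, ← div_eq_mul_inv, ← div_pow,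
      ENNReal.ofReal_rpow_of_nonneg (by positivity) hθ0, ← Real.rpow_natCast _ (N + 1), ← Real.rpow_mul h0,
      hθ, mul_div_cancel₀ _ hN.ne']
  simp_rw [hXp]
  calc ∫⁻ ξ, X ξ ^ θ * 1 ^ (1 - θ) ∂τ
      ≤ (∫⁻ ξ, X ξ ∂τ) ^ θ * (∫⁻ _, 1 ∂τ) ^ (1 - θ) :=
        ENNReal.lintegral_mul_norm_pow_le hXm.aemeasurable aemeasurable_const hθ0
          (by linarith) (by ring)
    _ ≤ τ Set.univ ^ θ * τ Set.univ ^ (1 - θ) := by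
        rw [lintegral_one]
        gcongr
    _ = τ Set.univ := by
        rw [← ENNReal.rpow_add_of_nonneg _ _ hθ0 (by linarith)]
        simp

theorem one_sub_inner_ne_zero {n : ℕ} {a z : Cn n} (ha : ‖a‖ < 1) (hz : ‖z‖ < 1) :
    1 - inner ℂ a z ≠ 0 := by
  intro h
  have h1 : ‖inner ℂ a z‖ ≤ ‖a‖ * ‖z‖ := norm_inner_le_norm a z
  rw [← sub_eq_zero.1 h, norm_one] at h1
  nlinarith [norm_nonneg a, norm_nonneg z]

/-- The basic identity of the automorphism `Φ_a` of the ball. -/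
theorem one_sub_norm_sq_ballAut {n : ℕ} {a z : Cn n} (ha : ‖a‖ < 1) (hz : ‖z‖ < 1) :
    1 - ‖ballAut a z‖ ^ 2 = (1 - ‖a‖ ^ 2) / ‖1 - inner ℂ a z‖ ^ 2 * (1 - ‖z‖ ^ 2) := by
  set K := Submodule.span ℂ {a}
  set w := K.starProjection z with hw
  have hwK : w ∈ K := K.starProjection_apply_mem z
  have haK : a ∈ K := Submodule.mem_span_singleton_self a
  have hq : z - w ∈ Kᗮ := K.sub_starProjection_mem_orthogonal z
  have hs : 0 ≤ 1 - ‖a‖ ^ 2 := sub_nonneg.2 (pow_le_one₀ (norm_nonneg _) ha.le)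
  have haw : inner ℂ a w = inner ℂ a z := by
    have := (Submodule.mem_orthogonal K _).1 hq a haK
    rw [inner_sub_right, sub_eq_zero] at this
    exact this.symm
  have hnw : ‖inner ℂ a z‖ ^ 2 = ‖a‖ ^ 2 * ‖w‖ ^ 2 := by
    obtain ⟨c, hc⟩ := Submodule.mem_span_singleton.1 hwK
    rw [← haw, ← hc, inner_smul_right, inner_self_eq_norm_sq_to_K, norm_smul]
    simp
    ring
  have hz2 : ‖z‖ ^ 2 = ‖w‖ ^ 2 + ‖z - w‖ ^ 2 := by
    have := norm_add_sq_eq_norm_sq_add_norm_sq_of_inner_eq_zero w (z - w)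
      ((Submodule.mem_orthogonal K _).1 hq w hwK)
    simpa [sq] using this
  have hnum : ‖a - w - ((Real.sqrt (1 - ‖a‖ ^ 2) : ℝ) : ℂ) • (z - w)‖ ^ 2 =
      ‖a - w‖ ^ 2 + (1 - ‖a‖ ^ 2) * ‖z - w‖ ^ 2 := by
    have h1 : inner ℂ (a - w) (-(((Real.sqrt (1 - ‖a‖ ^ 2) : ℝ) : ℂ) • (z - w))) = 0 := by
      rw [inner_neg_right, inner_smul_right,
        (Submodule.mem_orthogonal K _).1 hq _ (K.sub_mem haK hwK)]
      simp
    have := norm_add_sq_eq_norm_sq_add_norm_sq_of_inner_eq_zero _ _ h1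
    rw [← sub_eq_add_neg, norm_neg, norm_smul, Complex.norm_real,
      Real.norm_of_nonneg (Real.sqrt_nonneg _)] at this
    rw [sq, this, mul_mul_mul_comm, Real.mul_self_sqrt hs]
    ring
  have haw2 : ‖a - w‖ ^ 2 = ‖a‖ ^ 2 - 2 * (inner ℂ a z).re + ‖w‖ ^ 2 := by
    rw [@norm_sub_sq ℂ, haw]
    rfl
  have hD : ‖1 - inner ℂ a z‖ ^ 2 = 1 - 2 * (inner ℂ a z).re + ‖inner ℂ a z‖ ^ 2 := by
    rw [← Complex.normSq_eq_norm_sq, ← Complex.normSq_eq_norm_sq, Complex.normSq_apply,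
      Complex.normSq_apply]
    simp
    ring
  have hD0 : ‖1 - inner ℂ a z‖ ^ 2 ≠ 0 :=
    pow_ne_zero _ (norm_ne_zero_iff.2 (one_sub_inner_ne_zero ha hz))
  have hball : ‖ballAut a z‖ ^ 2 = (‖1 - inner ℂ a z‖ ^ 2)⁻¹ *
      (‖a - w‖ ^ 2 + (1 - ‖a‖ ^ 2) * ‖z - w‖ ^ 2) := by
    rw [ballAut, norm_smul, mul_pow, hnum, norm_inv, inv_pow]
  have hone : (‖1 - inner ℂ a z‖ ^ 2)⁻¹ * ‖1 - inner ℂ a z‖ ^ 2 = 1 := inv_mul_cancel₀ hD0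
  rw [hball, haw2, div_mul_eq_mul_div, eq_div_iff hD0, sub_mul, mul_right_comm, hone, hD, hnw, hz2]
  ring

/-! ### Lacunary and dyadic sums -/

/-- The Cauchy–Schwarz inequality for series. -/
theorem sq_tsum_le_tsum_mul_tsum {t u v : ℕ → ℝ≥0∞} (h : ∀ j, t j ^ 2 ≤ u j * v j) :
    (∑' j, t j) ^ 2 ≤ (∑' j, u j) * ∑' j, v j := by
  have h1 : ∑' j, t j ≤ (∑' j, u j) ^ (1 / 2 : ℝ) * (∑' j, v j) ^ (1 / 2 : ℝ) := by
    have h2 : ∀ j, t j ≤ u j ^ (1 / 2 : ℝ) * v j ^ (1 / 2 : ℝ) := fun j => by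
      rw [← ENNReal.mul_rpow_of_nonneg _ _ (by norm_num), one_div,
        ENNReal.le_rpow_inv_iff (by norm_num)]
      simpa using h j
    refine (ENNReal.tsum_le_tsum h2).trans ?_
    have := ENNReal.lintegral_mul_norm_pow_le (μ := Measure.count) (f := u) (g := v)
      (measurable_of_countable _).aemeasurable (measurable_of_countable _).aemeasurable
      (p := 1 / 2) (q := 1 / 2) (by norm_num) (by norm_num) (by norm_num)
    simpa only [lintegral_count] using this
  rw [← ENNReal.mul_rpow_of_nonneg _ _ (by norm_num), one_div,
    ENNReal.le_rpow_inv_iff (by norm_num)] at h1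
  simpa using h1

/-- Shifting the degrees by one keeps a gap condition and makes them positive. -/
theorem HadamardGaps.exists_ratio_succ {d : ℕ → ℕ} (hd : HadamardGaps d) :
    ∃ c : ℝ, 1 < c ∧ ∀ k, c * ((d k : ℝ) + 1) ≤ (d (k + 1) : ℝ) + 1 := by
  obtain ⟨hm, c, hc, hk⟩ := hd
  refine ⟨1 + min (c - 1) 1 / 2, by have := lt_min (sub_pos.2 hc) one_pos; linarith, fun k => ?_⟩
  have h1 := min_le_left (c - 1) 1
  have h2 := min_le_right (c - 1) 1
  have h3 : ((d k : ℕ) : ℝ) + 1 ≤ d (k + 1) := by exact_mod_cast hm (Nat.lt_succ_self k)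
  have h4 := hk k
  rcases Nat.eq_zero_or_pos (d k) with h0 | h0
  · rw [h0] at h3 ⊢
    push_cast at h3 ⊢
    linarith
  · have h5 : (1 : ℝ) ≤ d k := by exact_mod_cast h0
    nlinarith

/-- A lacunary sum `∑ (d_j + 1)^p r^(d_j)` is `O((1 - r)^(-p))`. By the gap condition
`(d_j + 1)^p` is at most a constant times the integral of `p t^(p-1)` between two consecutive
degrees, so the sum is bounded by a Gamma integral. -/
theorem HadamardGaps.tsum_rpow_mul_pow_le {d : ℕ → ℕ} (hd : HadamardGaps d) {p : ℝ} (hp : 0 < p) :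
    ∃ C : ℝ, 0 ≤ C ∧ ∀ r : ℝ, 0 ≤ r → r < 1 →
      ∑' j, ENNReal.ofReal (((d j : ℝ) + 1) ^ p * r ^ d j) ≤
        ENNReal.ofReal (C * (1 - r) ^ (-p)) := by
  obtain ⟨c, hc, hck⟩ := hd.exists_ratio_succ
  have hc0 : 0 < c := by linarith
  set D : ℕ → ℝ := fun j => (d j : ℝ) + 1 with hD
  have hD1 : ∀ j, 1 ≤ D j := fun j => by simp [hD]
  -- The endpoints `0, D 0, D 1, …` of the intervals of integration.
  let E : ℕ → ℝ := fun j => Nat.casesOn j 0 D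
  have hE0 : E 0 = 0 := rfl
  have hE1 : ∀ j, E (j + 1) = D j := fun j => rfl
  have hEnn : ∀ j, 0 ≤ E j := fun j => by
    cases j with
    | zero => exact le_rfl
    | succ j => rw [hE1]; linarith [hD1 j]
  have hEc : ∀ j, c * E j ≤ E (j + 1) := fun j => by
    cases j with
    | zero => rw [hE0, hE1]; linarith [hD1 0]
    | succ j => rw [hE1, hE1]; exact hck j
  have hEm : Monotone E := monotone_nat_of_le_succ fun j => by nlinarith [hEc j, hEnn j]
  set q : ℝ := 1 - (c⁻¹) ^ p with hq
  have hq0 : 0 < q := sub_pos.2 (Real.rpow_lt_one (by positivity) (inv_lt_one_of_one_lt₀ hc) hp)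
  have hstep : ∀ j, q * D j ^ p ≤ E (j + 1) ^ p - E j ^ p := fun j => by
    have h1 : E j ≤ c⁻¹ * D j := by
      rw [le_inv_mul_iff₀ hc0, ← hE1]; exact hEc j
    have h2 : E j ^ p ≤ (c⁻¹) ^ p * D j ^ p := by
      rw [← Real.mul_rpow (by positivity) (by linarith [hD1 j])]
      exact Real.rpow_le_rpow (hEnn j) h1 hp.le
    rw [hE1, hq]
    linarith
  refine ⟨q⁻¹ * Real.exp 1 * (p * Real.Gamma p), by positivity, fun r hr0 hr1 => ?_⟩
  set x : ℝ := 1 - r with hx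
  have hx0 : 0 < x := sub_pos.2 hr1
  have hx1 : x ≤ 1 := by linarith
  set φ : ℝ → ℝ := fun t => p * t ^ (p - 1) * Real.exp (-(x * t)) with hφ
  have hterm : ∀ j, ENNReal.ofReal (D j ^ p * r ^ d j) ≤
      ENNReal.ofReal (q⁻¹ * Real.exp 1) *
        ∫⁻ t in Set.Ioc (E j) (E (j + 1)), ENNReal.ofReal (φ t) := fun j => by
    have hI : ∫⁻ t in Set.Ioc (E j) (E (j + 1)), ENNReal.ofReal (p * t ^ (p - 1)) =
        ENNReal.ofReal (E (j + 1) ^ p - E j ^ p) := by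
      have hle : E j ≤ E (j + 1) := hEm (Nat.le_succ j)
      rw [← ofReal_integral_eq_lintegral_ofReal, ← intervalIntegral.integral_of_le hle,
        intervalIntegral.integral_const_mul, integral_rpow (Or.inl (by linarith))]
      · congr 1
        rw [sub_add_cancel]
        field_simp
      · exact ((intervalIntegral.intervalIntegrable_rpow' (by linarith)).const_mul p).1
      · filter_upwards [ae_restrict_mem measurableSet_Ioc] with t ht
        have : 0 < t := (hEnn j).trans_lt ht.1
        positivity
    have hr : r ^ d j ≤ Real.exp 1 * Real.exp (-(x * D j)) := by
      have h1 : r ≤ Real.exp (-x) := by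
        have := Real.add_one_le_exp (-x)
        linarith
      calc r ^ d j ≤ Real.exp (-x) ^ d j := pow_le_pow_left₀ hr0 h1 _
        _ = Real.exp x * Real.exp (-(x * D j)) := by
            rw [← Real.exp_nat_mul, ← Real.exp_add]
            congr 1
            simp only [hD]
            ring
        _ ≤ Real.exp 1 * Real.exp (-(x * D j)) := by gcongr
    have hDp : 0 ≤ D j ^ p := Real.rpow_nonneg (by linarith [hD1 j]) _
    calc ENNReal.ofReal (D j ^ p * r ^ d j)
        ≤ ENNReal.ofReal ((q⁻¹ * Real.exp 1) *
            ((E (j + 1) ^ p - E j ^ p) * Real.exp (-(x * D j)))) := by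
          refine ENNReal.ofReal_le_ofReal ?_
          calc D j ^ p * r ^ d j ≤ D j ^ p * (Real.exp 1 * Real.exp (-(x * D j))) := by gcongr
            _ = (q⁻¹ * Real.exp 1) * ((q * D j ^ p) * Real.exp (-(x * D j))) := by
                field_simp
            _ ≤ _ := by gcongr; exact hstep j
      _ = ENNReal.ofReal (q⁻¹ * Real.exp 1) * (ENNReal.ofReal (Real.exp (-(x * D j))) *
            ∫⁻ t in Set.Ioc (E j) (E (j + 1)), ENNReal.ofReal (p * t ^ (p - 1))) := by
          rw [hI, ENNReal.ofReal_mul (by positivity), mul_comm (_ - _) _,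
            ENNReal.ofReal_mul (Real.exp_nonneg _)]
      _ ≤ _ := by
          gcongr
          rw [← lintegral_const_mul _ (by fun_prop)]
          refine setLIntegral_mono (by fun_prop) fun t ht => ?_
          have ht0 : 0 < t := (hEnn j).trans_lt ht.1
          rw [← ENNReal.ofReal_mul (Real.exp_nonneg _), hφ, mul_comm]
          refine ENNReal.ofReal_le_ofReal (mul_le_mul_of_nonneg_left ?_ (by positivity))
          exact Real.exp_le_exp.2 (neg_le_neg (mul_le_mul_of_nonneg_left ht.2 hx0.le))
  refine (ENNReal.tsum_le_tsum hterm).trans ?_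
  rw [ENNReal.tsum_mul_left, mul_assoc (q⁻¹ * Real.exp 1),
    ENNReal.ofReal_mul (p := q⁻¹ * Real.exp 1) (by positivity)]
  gcongr
  have hdisj : Pairwise (Function.onFun Disjoint fun j => Set.Ioc (E j) (E (j + 1))) :=
    fun i j hij => hEm.pairwise_disjoint_on_Ioc_succ hij
  rw [← lintegral_iUnion (fun j => measurableSet_Ioc) hdisj]
  have hG := Real.integral_rpow_mul_exp_neg_mul_Ioi hp hx0
  have hφi : ∫ t in Set.Ioi (0 : ℝ), φ t = p * Real.Gamma p * x ^ (-p) := by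
    simp only [hφ, mul_assoc]
    rw [integral_const_mul, hG, Real.rpow_neg hx0.le, one_div, Real.inv_rpow hx0.le]
    ring
  calc ∫⁻ t in ⋃ j, Set.Ioc (E j) (E (j + 1)), ENNReal.ofReal (φ t)
      ≤ ∫⁻ t in Set.Ioi (0 : ℝ), ENNReal.ofReal (φ t) := by
        refine lintegral_mono_set (Set.iUnion_subset fun j t ht => ?_)
        exact (hEnn j).trans_lt ht.1
    _ = ENNReal.ofReal (∫ t in Set.Ioi (0 : ℝ), φ t) := by
        rw [ofReal_integral_eq_lintegral_ofReal]
        · refine Integrable.of_integral_ne_zero ?_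
          rw [hφi]
          have := Real.Gamma_pos_of_pos hp
          positivity
        · filter_upwards [ae_restrict_mem measurableSet_Ioi] with t ht
          have : 0 < t := ht
          simp only [hφ, Pi.zero_apply]
          positivity
    _ ≤ _ := by rw [hφi]

/-- A positive degree lies in exactly one dyadic block. -/
theorem tsum_dyadic_weight (p : ℝ) (m : ℕ) (hm : m ≠ 0) :
    (∑' k : ℕ, if 2 ^ k ≤ m ∧ m < 2 ^ (k + 1) then
        ENNReal.ofReal (1 / (2 : ℝ) ^ ((k : ℝ) * (1 + p))) else 0) =
      ENNReal.ofReal (1 / (2 : ℝ) ^ ((Nat.log 2 m : ℝ) * (1 + p))) := by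
  rw [tsum_eq_single (Nat.log 2 m), if_pos]
  · exact ⟨Nat.pow_log_le_self 2 hm, Nat.lt_pow_succ_log_self one_lt_two m⟩
  · intro k hk
    exact if_neg fun h => hk (Nat.log_eq_of_pow_le_of_lt_pow h.1 h.2).symm

theorem dyadicSum_eq (p : ℝ) (d : ℕ → ℕ) (x : ℕ → ℝ) :
    dyadicSum p d x = ∑' j, (∑' k : ℕ, if 2 ^ k ≤ d j ∧ d j < 2 ^ (k + 1) then
        ENNReal.ofReal (1 / (2 : ℝ) ^ ((k : ℝ) * (1 + p))) else 0) * ENNReal.ofReal (x j ^ 2) := by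
  simp_rw [← ENNReal.tsum_mul_right]
  rw [ENNReal.tsum_comm, dyadicSum]
  refine tsum_congr fun k => ?_
  rw [← ENNReal.tsum_mul_left]
  have h := tsum_subtype (fun j => 2 ^ k ≤ d j ∧ d j < 2 ^ (k + 1) : Set ℕ)
    (fun j => ENNReal.ofReal (1 / (2 : ℝ) ^ ((k : ℝ) * (1 + p))) * ENNReal.ofReal (x j ^ 2))
  refine h.trans (tsum_congr fun j => ?_)
  by_cases hj : 2 ^ k ≤ d j ∧ d j < 2 ^ (k + 1)
  · rw [if_pos hj]
    exact Set.indicator_of_mem (s := (fun j => 2 ^ k ≤ d j ∧ d j < 2 ^ (k + 1) : Set ℕ)) hj _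
  · rw [if_neg hj, zero_mul]
    exact Set.indicator_of_notMem (s := (fun j => 2 ^ k ≤ d j ∧ d j < 2 ^ (k + 1) : Set ℕ)) hj _

theorem two_rpow_neg_log_le {p : ℝ} (hp : 0 < p) (m : ℕ) :
    1 / (2 : ℝ) ^ ((Nat.log 2 m : ℝ) * (1 + p)) ≤
      (2 : ℝ) ^ (1 + p) * ((m : ℝ) + 1) ^ (-(1 + p)) := by
  have h1 : ((m : ℝ) + 1) ≤ 2 ^ (Nat.log 2 m + 1) := by
    exact_mod_cast Nat.lt_pow_succ_log_self one_lt_two m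
  have h2 : ((m : ℝ) + 1) ^ (1 + p) ≤ 2 ^ (1 + p) * 2 ^ ((Nat.log 2 m : ℝ) * (1 + p)) := by
    calc ((m : ℝ) + 1) ^ (1 + p) ≤ ((2 : ℝ) ^ (Nat.log 2 m + 1)) ^ (1 + p) :=
          Real.rpow_le_rpow (by positivity) h1 (by linarith)
      _ = _ := by
          rw [← Real.rpow_natCast, ← Real.rpow_mul (by norm_num),
            ← Real.rpow_add (by norm_num)]
          congr 1
          push_cast
          ring
  rw [Real.rpow_neg (by positivity), ← div_eq_mul_inv, div_le_div_iff₀ (by positivity)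
    (by positivity), one_mul]
  exact h2

theorem rpow_neg_le_two_rpow_neg_log {p : ℝ} (hp : 0 < p) {m : ℕ} (hm : m ≠ 0) :
    ((m : ℝ) + 1) ^ (-(1 + p)) ≤ 1 / (2 : ℝ) ^ ((Nat.log 2 m : ℝ) * (1 + p)) := by
  have h1 : (2 : ℝ) ^ Nat.log 2 m ≤ (m : ℝ) + 1 := by
    exact_mod_cast (Nat.pow_log_le_self 2 hm).trans (Nat.le_succ m)
  rw [Real.rpow_neg (by positivity), one_div]
  refine inv_anti₀ (by positivity) ?_
  rw [Real.rpow_mul (by norm_num), Real.rpow_natCast]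
  exact Real.rpow_le_rpow (by positivity) h1 (by linarith)

theorem dyadicSum_le {p : ℝ} (hp : 0 < p) (d : ℕ → ℕ) (x : ℕ → ℝ) :
    dyadicSum p d x ≤ ENNReal.ofReal ((2 : ℝ) ^ (1 + p)) *
      ∑' j, ENNReal.ofReal (((d j : ℝ) + 1) ^ (-(1 + p))) * ENNReal.ofReal (x j ^ 2) := by
  rw [dyadicSum_eq, ← ENNReal.tsum_mul_left]
  refine ENNReal.tsum_le_tsum fun j => ?_
  rw [← mul_assoc, ← ENNReal.ofReal_mul (by positivity)]
  gcongr
  by_cases hj : d j = 0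
  · simp [hj]
  · rw [tsum_dyadic_weight p _ hj]
    exact ENNReal.ofReal_le_ofReal (two_rpow_neg_log_le hp _)

/-- A finite dyadic sum makes the sum over all degrees finite, the degree zero, which the dyadic
blocks leave out, included. -/
theorem tsum_lt_top_of_dyadicSum_lt_top {p : ℝ} (hp : 0 < p) {d : ℕ → ℕ} (hd : StrictMono d)
    {x : ℕ → ℝ} (h : dyadicSum p d x < ∞) :
    ∑' j, ENNReal.ofReal (((d j : ℝ) + 1) ^ (-(1 + p))) * ENNReal.ofReal (x j ^ 2) < ∞ := by
  rw [dyadicSum_eq] at h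
  rw [tsum_eq_zero_add' ENNReal.summable]
  refine ENNReal.add_lt_top.2 ⟨ENNReal.mul_lt_top ENNReal.ofReal_lt_top ENNReal.ofReal_lt_top, ?_⟩
  rw [tsum_eq_zero_add' ENNReal.summable] at h
  refine lt_of_le_of_lt (ENNReal.tsum_le_tsum fun j => ?_) (ENNReal.add_lt_top.1 h).2
  have hj : d (j + 1) ≠ 0 := by
    have := hd (Nat.succ_pos j)
    simp only [Nat.succ_eq_add_one] at this
    omega
  rw [tsum_dyadic_weight p _ hj]
  gcongr
  exact rpow_neg_le_two_rpow_neg_log hp hj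

/-! ### Homogeneous polynomials on the ball -/

/-- The function on `ℂⁿ` given by a polynomial. -/
noncomputable def polyFun {n : ℕ} (P : MvPolynomial (Fin n) ℂ) (z : Cn n) : ℂ :=
  MvPolynomial.eval (fun i => z i) P

theorem continuous_polyFun {n : ℕ} (P : MvPolynomial (Fin n) ℂ) : Continuous (polyFun P) :=
  (MvPolynomial.continuous_eval P).comp (by fun_prop)

theorem polyFun_smul {n m : ℕ} {P : MvPolynomial (Fin n) ℂ} (hP : P.IsHomogeneous m) (w : ℂ)
    (z : Cn n) : polyFun P (w • z) = w ^ m * polyFun P z := by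
  simp only [polyFun, MvPolynomial.eval_eq, Finset.mul_sum]
  refine Finset.sum_congr rfl fun s hs => ?_
  have h1 : ∑ i ∈ s.support, s i = m := by
    have := hP (MvPolynomial.mem_support_iff.1 hs)
    rw [Finsupp.weight_apply] at this
    simpa [Finsupp.sum] using this
  simp only [PiLp.smul_apply, smul_eq_mul, mul_pow, Finset.prod_mul_distrib]
  rw [Finset.prod_pow_eq_pow_sum, h1]
  ring

theorem norm_polyFun_real_smul {n m : ℕ} {P : MvPolynomial (Fin n) ℂ} (hP : P.IsHomogeneous m)
    {r : ℝ} (hr : 0 ≤ r) (z : Cn n) : ‖polyFun P (r • z)‖ = r ^ m * ‖polyFun P z‖ := by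
  rw [← Complex.coe_smul, polyFun_smul hP, norm_mul, norm_pow, Complex.norm_real,
    Real.norm_of_nonneg hr]

theorem norm_polyFun_le {n m : ℕ} [NeZero n] {P : MvPolynomial (Fin n) ℂ} (hP : P.IsHomogeneous m)
    (z : Cn n) : ‖polyFun P z‖ ≤ sphereSup P * ‖z‖ ^ m := by
  have hbdd : BddAbove (Set.range fun ξ : sphere (0 : Cn n) 1 => ‖polyFun P ξ‖) :=
    (isCompact_range ((continuous_polyFun P).norm.comp continuous_subtype_val)).bddAbove
  have hle : ∀ ξ : sphere (0 : Cn n) 1, ‖polyFun P ξ‖ ≤ sphereSup P := fun ξ =>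
    le_ciSup hbdd ξ
  rcases eq_or_ne z 0 with rfl | hz
  · obtain ⟨ξ, hξ⟩ := exists_norm_eq (Cn n) zero_le_one
    have h1 := norm_polyFun_real_smul hP le_rfl ξ
    have h2 := hle ⟨ξ, by simpa using hξ⟩
    rw [zero_smul] at h1
    rw [h1, norm_zero, mul_comm]
    gcongr
  · have hz' : ‖z‖ ≠ 0 := norm_ne_zero_iff.2 hz
    have h1 : z = ‖z‖ • (‖z‖⁻¹ • z) := by rw [smul_smul, mul_inv_cancel₀ hz', one_smul]
    have h2 := hle ⟨‖z‖⁻¹ • z, by simp [norm_smul, hz']⟩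
    conv_lhs => rw [h1, norm_polyFun_real_smul hP (norm_nonneg z)]
    rw [mul_comm]
    gcongr

theorem ofReal_sphereL2_sq {n : ℕ} [NeZero n] (P : MvPolynomial (Fin n) ℂ) :
    ENNReal.ofReal (sphereL2 P ^ 2) =
      ((volume : Measure (Cn n)).toSphere Set.univ)⁻¹ *
        ∫⁻ ξ : sphere (0 : Cn n) 1, ENNReal.ofReal (‖polyFun P ξ‖ ^ 2)
          ∂(volume : Measure (Cn n)).toSphere := by
  have h0 : (volume : Measure (Cn n)).toSphere Set.univ ≠ 0 := fun h =>
    Measure.toSphere_ne_zero volume (Measure.measure_univ_eq_zero.1 h)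
  have hfin : IsFiniteMeasure (sphereMeasure n) := by
    refine ⟨?_⟩
    simp only [sphereMeasure, Measure.smul_apply, smul_eq_mul]
    exact ENNReal.mul_lt_top (ENNReal.inv_lt_top.2 (pos_iff_ne_zero.2 h0)) (measure_lt_top _ _)
  have hint : Integrable (fun ξ : sphere (0 : Cn n) 1 => ‖polyFun P ξ‖ ^ 2) (sphereMeasure n) :=
    (((continuous_polyFun P).norm.comp continuous_subtype_val).pow 2).integrable_of_hasCompactSupport
      (HasCompactSupport.of_compactSpace _)
  rw [sphereL2, Real.sq_sqrt (integral_nonneg fun ξ => by positivity)]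
  have := ofReal_integral_eq_lintegral_ofReal hint (ae_of_all _ fun ξ => by positivity)
  rw [sphereMeasure, lintegral_smul_measure, smul_eq_mul] at this
  exact this

/-! ### From `N_p` to the `L²` norms of the homogeneous terms -/

/-- The Beta integral of `r^(2n-1+2m) (1 - r²)^p` over `(0, 1)` is at least a constant times
`(m + 1)^(-(1 + p))`. -/
theorem radial_weight_ge {N : ℕ} {p : ℝ} (hp : 0 < p) (m : ℕ) :
    ENNReal.ofReal ((1 / 2) ^ (2 * (N + 1)) * (1 / 4) ^ (1 + p) * ((m : ℝ) + 1) ^ (-(1 + p))) ≤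
      ∫⁻ r in Set.Ioi (0 : ℝ), ENNReal.ofReal (r ^ (2 * (N + 1) - 1 + 2 * m)) *
        (Set.Iio (1 : ℝ)).indicator (fun r => ENNReal.ofReal ((1 - r ^ 2) ^ p)) r := by
  set D : ℝ := (m : ℝ) + 1 with hD
  have hD1 : 1 ≤ D := by simp [hD]
  have hD0 : 0 < D := by linarith
  set x : ℝ := 1 / (4 * D) with hx
  have hx0 : 0 < x := by positivity
  have hx4 : x ≤ 1 / 4 := by
    rw [hx]; exact one_div_le_one_div_of_le (by norm_num) (by linarith)
  have hxD : D * x = 1 / 4 := by rw [hx]; field_simp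
  -- The integrand is bounded below on the interval `[1 - 2x, 1 - x]` of length `x = 1 / (4 (m + 1))`.
  have hsub : Set.Icc (1 - 2 * x) (1 - x) ⊆ Set.Ioi 0 := fun r hr => by
    have := hr.1
    simp only [Set.mem_Ioi]; linarith
  have hpt : ∀ r ∈ Set.Icc (1 - 2 * x) (1 - x),
      ENNReal.ofReal ((1 / 2) ^ (2 * (N + 1)) * x ^ p) ≤
      ENNReal.ofReal (r ^ (2 * (N + 1) - 1 + 2 * m)) *
        (Set.Iio (1 : ℝ)).indicator (fun r => ENNReal.ofReal ((1 - r ^ 2) ^ p)) r := by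
    intro r hr
    have hr0 : 0 < r := hsub hr
    have hr1 : r < 1 := by linarith [hr.2]
    rw [Set.indicator_of_mem (Set.mem_Iio.2 hr1), ← ENNReal.ofReal_mul (by positivity)]
    refine ENNReal.ofReal_le_ofReal (mul_le_mul ?_ ?_ (by positivity) (by positivity))
    · have hb : 1 / 2 ≤ r ^ (m + 1) := by
        have h1 := one_add_mul_le_pow (a := -(2 * x)) (by linarith) (m + 1)
        calc (1 / 2 : ℝ) = 1 + ((m + 1 : ℕ) : ℝ) * -(2 * x) := by
              push_cast; rw [← hD]; linarith
          _ ≤ (1 + -(2 * x)) ^ (m + 1) := h1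
          _ ≤ r ^ (m + 1) := pow_le_pow_left₀ (by linarith) (by linarith [hr.1]) _
      calc (1 / 2 : ℝ) ^ (2 * (N + 1)) ≤ (r ^ (m + 1)) ^ (2 * (N + 1)) := by gcongr
        _ = r ^ ((m + 1) * (2 * (N + 1))) := (pow_mul _ _ _).symm
        _ ≤ _ := by
            refine pow_le_pow_of_le_one hr0.le hr1.le ?_
            have : (m + 1) * (2 * (N + 1)) = 2 * (N + 1) + 2 * m + 2 * (m * N) := by ring
            omega
    · refine Real.rpow_le_rpow hx0.le ?_ hp.le
      nlinarith [hr.2]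
  calc ENNReal.ofReal ((1 / 2) ^ (2 * (N + 1)) * (1 / 4) ^ (1 + p) * D ^ (-(1 + p)))
      = ENNReal.ofReal ((1 / 2) ^ (2 * (N + 1)) * x ^ p) *
          volume (Set.Icc (1 - 2 * x) (1 - x)) := by
        rw [Real.volume_Icc, ← ENNReal.ofReal_mul (by positivity)]
        congr 1
        rw [show 1 - x - (1 - 2 * x) = x by ring, mul_assoc, mul_assoc,
          ← Real.rpow_add_one hx0.ne', Real.rpow_neg hD0.le, ← Real.inv_rpow hD0.le,
          ← Real.mul_rpow (by norm_num) (by positivity), add_comm p 1, hx]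
        congr 2
        field_simp
    _ = ∫⁻ r in Set.Icc (1 - 2 * x) (1 - x),
          ENNReal.ofReal ((1 / 2) ^ (2 * (N + 1)) * x ^ p) := by
        rw [setLIntegral_const]
    _ ≤ _ := (setLIntegral_mono' measurableSet_Icc hpt).trans (lintegral_mono_set hsub)

/-- Parseval's identity for a series of homogeneous polynomials in the weighted Bergman norm. -/
theorem setLIntegral_ball_norm_sq_eq {n : ℕ} {f : Cn n → ℂ} (hf : ContinuousOn f (ball 0 1))
    {d : ℕ → ℕ} (hd : Function.Injective d) {P : ℕ → MvPolynomial (Fin n) ℂ}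
    (hP : ∀ k, (P k).IsHomogeneous (d k))
    (hfP : ∀ z ∈ ball (0 : Cn n) 1, HasSum (fun k => polyFun (P k) z) (f z))
    {h : ℝ → ℝ≥0∞} (hh : Measurable h) :
    ∫⁻ z in ball (0 : Cn n) 1, h ‖z‖ * ENNReal.ofReal (‖f z‖ ^ 2) =
      ∑' k, ∫⁻ z in ball (0 : Cn n) 1, h ‖z‖ * ENNReal.ofReal (‖polyFun (P k) z‖ ^ 2) := by
  have hrot : ∀ w : ℂ, ‖w‖ = 1 → ∀ z ∈ ball (0 : Cn n) 1, w • z ∈ ball (0 : Cn n) 1 :=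
    fun w hw z hz => by simpa [norm_smul, hw] using hz
  rw [← lintegral_norm_sq_sum_homogeneous (ν := volume.restrict (ball (0 : Cn n) 1))
    (fun w hw g hg => ?_) hd (F := fun k => polyFun (P k))
    (fun k => (continuous_polyFun (P k)).measurable) (fun k w z => polyFun_smul (hP k) w z)
    (S := ball 0 1) (ae_restrict_mem measurableSet_ball) hrot
    (G := (ball (0 : Cn n) 1).indicator f) ?_ (fun z hz => ?_) hh]
  · refine setLIntegral_congr_fun measurableSet_ball fun z hz => ?_
    simp only [Set.indicator_of_mem hz]
  · classical
    rw [← Set.piecewise_eq_indicator]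
    exact hf.measurable_piecewise continuousOn_const measurableSet_ball
  · rw [← lintegral_indicator measurableSet_ball, ← lintegral_indicator measurableSet_ball,
      ← lintegral_volume_rotate hw (hg.indicator measurableSet_ball)]
    refine lintegral_congr fun z => ?_
    simp only [Set.indicator, mem_ball_zero_iff, norm_smul, hw, one_mul]
  · rw [Set.indicator_of_mem hz]
    exact hfP z hz

theorem npIntegral_zero {n : ℕ} (p : ℝ) (f : Cn n → ℂ) :
    npIntegral p f 0 = (volume (ball (0 : Cn n) 1))⁻¹ *
      ∫⁻ z in ball (0 : Cn n) 1, ENNReal.ofReal ((1 - ‖z‖ ^ 2) ^ p) *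
        ENNReal.ofReal (‖f z‖ ^ 2) := by
  rw [npIntegral, ballMeasure, lintegral_smul_measure, smul_eq_mul]
  congr 1
  refine setLIntegral_congr_fun measurableSet_ball fun z hz => ?_
  rw [mem_ball_zero_iff] at hz
  rw [one_sub_norm_sq_ballAut (by simp) hz, mul_comm, ENNReal.ofReal_mul]
  · simp
  · have : 0 ≤ 1 - ‖z‖ ^ 2 := sub_nonneg.2 (pow_le_one₀ (norm_nonneg _) hz.le)
    simpa using Real.rpow_nonneg this p

/-- A function in `N_p` has finite integral for `a = 0`, and Parseval's identity expresses this
integral by the `L²` norms on the sphere. -/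
theorem dyadicSum_sphereL2_lt_top {N : ℕ} {p : ℝ} (hp : 0 < p)
    {f : Cn (N + 1) → ℂ} {d : ℕ → ℕ} (hd : Function.Injective d)
    {P : ℕ → MvPolynomial (Fin (N + 1)) ℂ} (hP : ∀ k, (P k).IsHomogeneous (d k))
    (hfP : ∀ z ∈ ball (0 : Cn (N + 1)) 1, HasSum (fun k => polyFun (P k) z) (f z))
    (hf : f ∈ Np (N + 1) p) : dyadicSum p d (fun k => sphereL2 (P k)) < ∞ := by
  obtain ⟨hdiff, hnorm⟩ := hf
  have h0 : npIntegral p f 0 < ∞ := by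
    have h1 : npIntegral p f 0 ^ (1 / 2 : ℝ) ≤ npNorm p f :=
      le_iSup₂ (f := fun (a : Cn (N + 1)) (_ : a ∈ ball (0 : Cn (N + 1)) 1) =>
        npIntegral p f a ^ (1 / 2 : ℝ)) 0 (by simp)
    have h2 := h1.trans_lt hnorm
    by_contra h3
    rw [not_lt_top_iff.1 h3, ENNReal.top_rpow_of_pos (by norm_num)] at h2
    exact lt_irrefl _ h2
  have hV0 : volume (ball (0 : Cn (N + 1)) 1) ≠ 0 := (measure_ball_pos _ _ one_pos).ne'
  have hVt : volume (ball (0 : Cn (N + 1)) 1) ≠ ∞ := measure_ball_lt_top.ne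
  set τ := (volume : Measure (Cn (N + 1))).toSphere with hτ
  have hτ0 : τ Set.univ ≠ 0 := fun h =>
    Measure.toSphere_ne_zero volume (Measure.measure_univ_eq_zero.1 h)
  have hτt : τ Set.univ ≠ ∞ := measure_ne_top _ _
  rw [npIntegral_zero, setLIntegral_ball_norm_sq_eq hdiff.continuousOn hd hP hfP
    (h := fun r => ENNReal.ofReal ((1 - r ^ 2) ^ p)) (by fun_prop)] at h0
  have h1 : ∑' k, ∫⁻ z in ball (0 : Cn (N + 1)) 1, ENNReal.ofReal ((1 - ‖z‖ ^ 2) ^ p) *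
      ENNReal.ofReal (‖polyFun (P k) z‖ ^ 2) ≠ ∞ := fun h => by
    rw [h, ENNReal.mul_top (ENNReal.inv_ne_zero.2 hVt)] at h0
    exact lt_irrefl _ h0
  set c : ℝ := (1 / 2) ^ (2 * (N + 1)) * (1 / 4) ^ (1 + p) with hc
  have hc0 : 0 < c := by positivity
  have hterm : ∀ k, (ENNReal.ofReal c * τ Set.univ) *
      (ENNReal.ofReal (((d k : ℝ) + 1) ^ (-(1 + p))) * ENNReal.ofReal (sphereL2 (P k) ^ 2)) ≤
      ∫⁻ z in ball (0 : Cn (N + 1)) 1, ENNReal.ofReal ((1 - ‖z‖ ^ 2) ^ p) *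
        ENNReal.ofReal (‖polyFun (P k) z‖ ^ 2) := fun k => by
    have hm : Measurable (polyFun (P k)) := (continuous_polyFun (P k)).measurable
    have h2 := lintegral_radial_mul_homogeneous (volume : Measure (Cn (N + 1)))
      (G := fun z => ENNReal.ofReal (‖polyFun (P k) z‖ ^ 2)) (by fun_prop)
      (h := (Set.Iio (1 : ℝ)).indicator fun r => ENNReal.ofReal ((1 - r ^ 2) ^ p))
      (Measurable.indicator (by fun_prop) measurableSet_Iio) (2 * d k) (by
        intro r z hr
        rw [norm_polyFun_real_smul (hP k) hr.le, ← ENNReal.ofReal_mul (by positivity)]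
        congr 1
        ring)
    rw [finrank_real_Cn] at h2
    have h3 : ∫⁻ z in ball (0 : Cn (N + 1)) 1, ENNReal.ofReal ((1 - ‖z‖ ^ 2) ^ p) *
        ENNReal.ofReal (‖polyFun (P k) z‖ ^ 2) = ∫⁻ z : Cn (N + 1),
        (Set.Iio (1 : ℝ)).indicator (fun r => ENNReal.ofReal ((1 - r ^ 2) ^ p)) ‖z‖ *
          ENNReal.ofReal (‖polyFun (P k) z‖ ^ 2) := by
      rw [← lintegral_indicator measurableSet_ball]
      refine lintegral_congr fun z => ?_
      by_cases hz : ‖z‖ < 1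
      · rw [Set.indicator_of_mem (mem_ball_zero_iff.2 hz), Set.indicator_of_mem (Set.mem_Iio.2 hz)]
      · rw [Set.indicator_of_notMem (fun h => hz (mem_ball_zero_iff.1 h)),
          Set.indicator_of_notMem (by simpa using hz), zero_mul]
    rw [h3, h2, ofReal_sphereL2_sq]
    calc _ = (ENNReal.ofReal c * ENNReal.ofReal (((d k : ℝ) + 1) ^ (-(1 + p)))) *
          (τ Set.univ * (τ Set.univ)⁻¹) *
          ∫⁻ ξ : sphere (0 : Cn (N + 1)) 1, ENNReal.ofReal (‖polyFun (P k) ξ‖ ^ 2) ∂τ := by ring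
      _ = ENNReal.ofReal (c * ((d k : ℝ) + 1) ^ (-(1 + p))) *
          ∫⁻ ξ : sphere (0 : Cn (N + 1)) 1, ENNReal.ofReal (‖polyFun (P k) ξ‖ ^ 2) ∂τ := by
          rw [ENNReal.mul_inv_cancel hτ0 hτt, mul_one, ENNReal.ofReal_mul hc0.le]
      _ ≤ _ := by
          gcongr
          exact radial_weight_ge hp (d k)
  have h4 := ENNReal.tsum_le_tsum hterm
  rw [ENNReal.tsum_mul_left] at h4
  refine (dyadicSum_le hp d _).trans_lt (ENNReal.mul_lt_top ENNReal.ofReal_lt_top ?_)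
  refine lt_top_iff_ne_top.2 fun h5 => h1 (top_le_iff.1 ?_)
  rw [h5, ENNReal.mul_top] at h4
  · exact h4
  · exact mul_ne_zero (by simpa using hc0) hτ0

/-! ### From the sup norms of the homogeneous terms to the little space -/

/-- The radial majorant `∑ (d_j + 1)^(-p) M_j² r^(d_j)` of `|f(z)|² (1 - |z|²)^p` on `|z| = r`. -/
noncomputable def radialMajorant (p : ℝ) (d : ℕ → ℕ) (M : ℕ → ℝ) (r : ℝ) : ℝ≥0∞ :=
  ∑' j, ENNReal.ofReal (((d j : ℝ) + 1) ^ (-p)) * ENNReal.ofReal (M j ^ 2) *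
    ENNReal.ofReal (r ^ d j)

theorem measurable_radialMajorant (p : ℝ) (d : ℕ → ℕ) (M : ℕ → ℝ) :
    Measurable (radialMajorant p d M) :=
  Measurable.tsum fun j => by fun_prop

theorem lintegral_radialMajorant (p : ℝ) (d : ℕ → ℕ) (M : ℕ → ℝ) :
    ∫⁻ r in Set.Ioo (0 : ℝ) 1, radialMajorant p d M r =
      ∑' j, ENNReal.ofReal (((d j : ℝ) + 1) ^ (-(1 + p))) * ENNReal.ofReal (M j ^ 2) := by
  simp only [radialMajorant]
  rw [lintegral_tsum fun j => by fun_prop]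
  refine tsum_congr fun j => ?_
  have h1 : ∫⁻ r in Set.Ioo (0 : ℝ) 1, ENNReal.ofReal (r ^ d j) =
      ENNReal.ofReal (((d j : ℝ) + 1)⁻¹) := by
    rw [Measure.restrict_congr_set Ioo_ae_eq_Ioc, ← ofReal_integral_eq_lintegral_ofReal,
      ← intervalIntegral.integral_of_le zero_le_one]
    · simp
    · exact (intervalIntegral.intervalIntegrable_pow (d j)).1
    · filter_upwards [ae_restrict_mem measurableSet_Ioc] with r hr
      exact pow_nonneg hr.1.le _
  rw [lintegral_const_mul _ (by fun_prop), h1, mul_right_comm, ← ENNReal.ofReal_mul (by positivity)]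
  congr 3
  rw [← Real.rpow_neg_one, ← Real.rpow_add (by positivity)]
  congr 1
  ring

/-- The Cauchy–Schwarz inequality with the weights `(d_j + 1)^p`, whose lacunary sum is controlled
by the gap condition. -/
theorem exists_norm_sq_mul_le_radialMajorant {n : ℕ} [NeZero n] {p : ℝ} (hp : 0 < p)
    {f : Cn n → ℂ} {d : ℕ → ℕ} (hd : HadamardGaps d) {P : ℕ → MvPolynomial (Fin n) ℂ}
    (hP : ∀ k, (P k).IsHomogeneous (d k))
    (hfP : ∀ z ∈ ball (0 : Cn n) 1, HasSum (fun k => polyFun (P k) z) (f z)) :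
    ∃ C : ℝ≥0∞, C ≠ ∞ ∧ ∀ z ∈ ball (0 : Cn n) 1,
      ENNReal.ofReal (‖f z‖ ^ 2) * ENNReal.ofReal ((1 - ‖z‖ ^ 2) ^ p) ≤
        C * radialMajorant p d (fun k => sphereSup (P k)) ‖z‖ := by
  obtain ⟨C, hC0, hC⟩ := hd.tsum_rpow_mul_pow_le hp
  refine ⟨ENNReal.ofReal (C * 2 ^ p), ENNReal.ofReal_ne_top, fun z hz => ?_⟩
  have hz1 : ‖z‖ < 1 := mem_ball_zero_iff.1 hz
  have hz0 := norm_nonneg z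
  set M : ℕ → ℝ := fun k => sphereSup (P k) with hM
  have h1 : ENNReal.ofReal ‖f z‖ ≤ ∑' j, ENNReal.ofReal (M j * ‖z‖ ^ d j) := by
    rw [← (hfP z hz).tsum_eq, ofReal_norm]
    refine enorm_tsum_le_tsum_enorm.trans (ENNReal.tsum_le_tsum fun j => ?_)
    rw [← ofReal_norm]
    exact ENNReal.ofReal_le_ofReal (norm_polyFun_le (hP j) z)
  have h2 : (∑' j, ENNReal.ofReal (M j * ‖z‖ ^ d j)) ^ 2 ≤
      (∑' j, ENNReal.ofReal (((d j : ℝ) + 1) ^ p * ‖z‖ ^ d j)) * radialMajorant p d M ‖z‖ := by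
    refine sq_tsum_le_tsum_mul_tsum fun j => ?_
    have hD : (0 : ℝ) < (d j : ℝ) + 1 := by positivity
    have hM0 : 0 ≤ M j := Real.iSup_nonneg fun ξ => norm_nonneg _
    rw [← ENNReal.ofReal_pow (by positivity), ← ENNReal.ofReal_mul (by positivity),
      ← ENNReal.ofReal_mul (by positivity), ← ENNReal.ofReal_mul (by positivity)]
    refine ENNReal.ofReal_le_ofReal (le_of_eq ?_)
    have h3 : ((d j : ℝ) + 1) ^ p * ((d j : ℝ) + 1) ^ (-p) = 1 := by
      rw [← Real.rpow_add hD]; simp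
    calc (M j * ‖z‖ ^ d j) ^ 2 = 1 * (M j * ‖z‖ ^ d j) ^ 2 := by ring
      _ = (((d j : ℝ) + 1) ^ p * ((d j : ℝ) + 1) ^ (-p)) * (M j * ‖z‖ ^ d j) ^ 2 := by rw [h3]
      _ = _ := by ring
  have hw : (1 - ‖z‖) ^ (-p) * (1 - ‖z‖ ^ 2) ^ p ≤ 2 ^ p := by
    have h4 : 0 < 1 - ‖z‖ := sub_pos.2 hz1
    rw [show 1 - ‖z‖ ^ 2 = (1 - ‖z‖) * (1 + ‖z‖) by ring, Real.mul_rpow h4.le (by positivity),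
      ← mul_assoc, ← Real.rpow_add h4, neg_add_cancel, Real.rpow_zero, one_mul]
    exact Real.rpow_le_rpow (by positivity) (by linarith) hp.le
  have h5 : 0 ≤ (1 - ‖z‖) ^ (-p) := Real.rpow_nonneg (sub_nonneg.2 hz1.le) _
  calc ENNReal.ofReal (‖f z‖ ^ 2) * ENNReal.ofReal ((1 - ‖z‖ ^ 2) ^ p)
      ≤ (ENNReal.ofReal (C * (1 - ‖z‖) ^ (-p)) * radialMajorant p d M ‖z‖) *
          ENNReal.ofReal ((1 - ‖z‖ ^ 2) ^ p) := by
        gcongr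
        rw [ENNReal.ofReal_pow (norm_nonneg _)]
        exact (pow_le_pow_left₀ (zero_le) h1 2).trans (h2.trans (by gcongr; exact hC _ hz0 hz1))
    _ = ENNReal.ofReal (C * ((1 - ‖z‖) ^ (-p) * (1 - ‖z‖ ^ 2) ^ p)) *
          radialMajorant p d M ‖z‖ := by
        rw [mul_right_comm, ← ENNReal.ofReal_mul (by positivity), mul_assoc C]
    _ ≤ _ := by gcongr

/-- A bound for the normalized integral of `((1 - |a|²) / |1 - ⟨z, a⟩|²)^p` over `|z| = r`,
where `s = |a|`. It never exceeds `1` and tends to `0` as `s → 1` with `r < 1` fixed. -/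
noncomputable def kernelBound (p s r : ℝ) : ℝ :=
  min 1 (((1 - s ^ 2) / (1 - r) ^ 2) ^ p)

theorem lintegral_kernel_le_kernelBound {N : ℕ} {p : ℝ} (hp : 0 < p) (hpn : p ≤ (N + 1 : ℕ))
    {a : Cn (N + 1)} (ha : ‖a‖ < 1) {r : ℝ} (hr0 : 0 ≤ r) (hr1 : r < 1) :
    ∫⁻ ξ : sphere (0 : Cn (N + 1)) 1, ENNReal.ofReal
      (((1 - ‖a‖ ^ 2) / ‖1 - inner ℂ a (r • (ξ : Cn (N + 1)))‖ ^ 2) ^ p)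
        ∂(volume : Measure (Cn (N + 1))).toSphere ≤
      ENNReal.ofReal (kernelBound p ‖a‖ r) *
        (volume : Measure (Cn (N + 1))).toSphere Set.univ := by
  have ha2 : 0 ≤ 1 - ‖a‖ ^ 2 := sub_nonneg.2 (pow_le_one₀ (norm_nonneg _) ha.le)
  rw [kernelBound, ENNReal.ofReal_min, min_mul_of_nonneg _ _ (zero_le), le_min_iff]
  constructor
  · simpa using lintegral_kernel_rpow_le hp hpn ha hr0 hr1
  · rw [← lintegral_const]
    refine lintegral_mono fun ξ => ENNReal.ofReal_le_ofReal ?_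
    have h1 : 1 - r ≤ ‖1 - inner ℂ a (r • (ξ : Cn (N + 1)))‖ := by
      have h2 : ‖inner ℂ a (r • (ξ : Cn (N + 1)))‖ ≤ 1 * r := by
        refine (norm_inner_le_norm _ _).trans ?_
        rw [norm_smul, Real.norm_of_nonneg hr0, norm_eq_of_mem_sphere ξ, mul_one]
        gcongr
      have h3 := norm_sub_norm_le (1 : ℂ) (inner ℂ a (r • (ξ : Cn (N + 1))))
      rw [norm_one] at h3
      linarith
    have h4 : 0 < 1 - r := sub_pos.2 hr1
    gcongr

/-- A radial majorant of `|f(z)|² (1 - |z|²)^p` bounds the integrals defining `N_p` by radial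
ones: integrate the kernel over the spheres `|z| = r` first. -/
theorem npIntegral_le_lintegral_radial {N : ℕ} {p : ℝ} (hp : 0 < p) (hpn : p ≤ (N + 1 : ℕ))
    {f : Cn (N + 1) → ℂ} {C : ℝ≥0∞} {g : ℝ → ℝ≥0∞} (hg : Measurable g)
    (hf : ∀ z ∈ ball (0 : Cn (N + 1)) 1,
      ENNReal.ofReal (‖f z‖ ^ 2) * ENNReal.ofReal ((1 - ‖z‖ ^ 2) ^ p) ≤ C * g ‖z‖)
    {a : Cn (N + 1)} (ha : ‖a‖ < 1) :
    npIntegral p f a ≤ ((volume (ball (0 : Cn (N + 1)) 1))⁻¹ *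
      (C * (volume : Measure (Cn (N + 1))).toSphere Set.univ)) *
        ∫⁻ r in Set.Ioo (0 : ℝ) 1, g r * ENNReal.ofReal (kernelBound p ‖a‖ r) := by
  have ha2 : 0 ≤ 1 - ‖a‖ ^ 2 := sub_nonneg.2 (pow_le_one₀ (norm_nonneg _) ha.le)
  have hbm : Measurable fun r => g r * ENNReal.ofReal (kernelBound p ‖a‖ r) := by
    unfold kernelBound
    fun_prop
  rw [npIntegral, ballMeasure, lintegral_smul_measure, smul_eq_mul, mul_assoc]
  gcongr
  set κ : Cn (N + 1) → ℝ≥0∞ := fun z =>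
    ENNReal.ofReal (((1 - ‖a‖ ^ 2) / ‖1 - inner ℂ a z‖ ^ 2) ^ p) with hκ
  have hκm : Measurable κ := by fun_prop
  calc ∫⁻ z in ball (0 : Cn (N + 1)) 1,
        ENNReal.ofReal (‖f z‖ ^ 2 * (1 - ‖ballAut a z‖ ^ 2) ^ p)
      ≤ ∫⁻ z in ball (0 : Cn (N + 1)) 1, C * (g ‖z‖ * κ z) := by
        refine setLIntegral_mono (by fun_prop) fun z hz => ?_
        have hz1 : ‖z‖ < 1 := mem_ball_zero_iff.1 hz
        have hz2 : 0 ≤ 1 - ‖z‖ ^ 2 := sub_nonneg.2 (pow_le_one₀ (norm_nonneg _) hz1.le)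
        rw [one_sub_norm_sq_ballAut ha hz1, Real.mul_rpow (by positivity) hz2,
          mul_left_comm, ENNReal.ofReal_mul (by positivity), ENNReal.ofReal_mul (by positivity),
          mul_comm, ← mul_assoc]
        gcongr ?_ * κ z
        exact hf z hz
    _ = C * ∫⁻ z : Cn (N + 1), (ball (0 : Cn (N + 1)) 1).indicator (fun z => g ‖z‖ * κ z) z := by
        rw [lintegral_const_mul _ (by fun_prop), lintegral_indicator measurableSet_ball]
    _ ≤ C * ∫⁻ r in Set.Ioi (0 : ℝ), (Set.Ioo (0 : ℝ) 1).indicator (fun r =>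
          (volume : Measure (Cn (N + 1))).toSphere Set.univ *
            (g r * ENNReal.ofReal (kernelBound p ‖a‖ r))) r := by
        rw [lintegral_eq_lintegral_polar volume
          (Measurable.indicator (by fun_prop) measurableSet_ball)]
        gcongr 1
        refine setLIntegral_mono (Measurable.indicator (hbm.const_mul _) measurableSet_Ioo)
          fun r hr => ?_
        have hr0 : 0 < r := hr
        have hnorm : ∀ ξ : sphere (0 : Cn (N + 1)) 1, ‖r • (ξ : Cn (N + 1))‖ = r := fun ξ => by
          rw [norm_smul, Real.norm_of_nonneg hr0.le, norm_eq_of_mem_sphere ξ, mul_one]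
        by_cases hr1 : r < 1
        · rw [Set.indicator_of_mem (show r ∈ Set.Ioo (0 : ℝ) 1 from ⟨hr0, hr1⟩)]
          have hin : ∀ ξ : sphere (0 : Cn (N + 1)) 1,
              (ball (0 : Cn (N + 1)) 1).indicator (fun z => g ‖z‖ * κ z) (r • (ξ : Cn (N + 1))) =
                g r * κ (r • (ξ : Cn (N + 1))) := fun ξ => by
            rw [Set.indicator_of_mem (by rw [mem_ball_zero_iff, hnorm]; exact hr1), hnorm]
          simp_rw [hin]
          rw [lintegral_const_mul _ (by fun_prop)]
          calc _ ≤ 1 * (g r * (ENNReal.ofReal (kernelBound p ‖a‖ r) *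
                (volume : Measure (Cn (N + 1))).toSphere Set.univ)) := by
                gcongr
                · exact ENNReal.ofReal_le_one.2 (pow_le_one₀ hr0.le hr1.le)
                · exact lintegral_kernel_le_kernelBound hp hpn ha hr0.le hr1
            _ = _ := by ring
        · have hin : ∀ ξ : sphere (0 : Cn (N + 1)) 1,
              (ball (0 : Cn (N + 1)) 1).indicator (fun z => g ‖z‖ * κ z) (r • (ξ : Cn (N + 1))) =
                0 := fun ξ =>
            Set.indicator_of_notMem (by rw [mem_ball_zero_iff, hnorm]; exact hr1) _
          simp [hin]
    _ = _ := by
        rw [lintegral_indicator measurableSet_Ioo, Measure.restrict_restrict measurableSet_Ioo,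
          Set.inter_eq_left.2 Set.Ioo_subset_Ioi_self, lintegral_const_mul _ hbm, mul_assoc]

theorem tendsto_lintegral_mul_kernelBound {p : ℝ} (hp : 0 < p) {g : ℝ → ℝ≥0∞} (hg : Measurable g)
    (hgi : ∫⁻ r in Set.Ioo (0 : ℝ) 1, g r ≠ ∞) :
    Tendsto (fun s : ℝ => ∫⁻ r in Set.Ioo (0 : ℝ) 1, g r * ENNReal.ofReal (kernelBound p s r))
      (𝓝[<] 1) (𝓝 0) := by
  have h := tendsto_lintegral_filter_of_dominated_convergence
    (μ := volume.restrict (Set.Ioo (0 : ℝ) 1)) (l := 𝓝[<] (1 : ℝ))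
    (F := fun s r => g r * ENNReal.ofReal (kernelBound p s r)) (f := fun _ => 0) g
    (Eventually.of_forall fun s => by unfold kernelBound; fun_prop)
    (Eventually.of_forall fun s => ae_of_all _ fun r =>
      mul_le_of_le_one_right' (ENNReal.ofReal_le_one.2 (min_le_left _ _))) hgi ?_
  · simpa using h
  · filter_upwards [ae_lt_top hg hgi, ae_restrict_mem measurableSet_Ioo] with r hr hr1
    have h0 : Tendsto (fun s : ℝ => kernelBound p s r) (𝓝[<] 1) (𝓝 0) := by
      have hc : ContinuousAt (fun s : ℝ => kernelBound p s r) 1 := by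
        unfold kernelBound
        refine continuousAt_const.min (ContinuousAt.rpow_const ?_ (Or.inr hp.le))
        fun_prop
      have h1 : kernelBound p 1 r = 0 := by
        simp [kernelBound, Real.zero_rpow hp.ne']
      have := hc.tendsto
      rw [h1] at this
      exact this.mono_left nhdsWithin_le_nhds
    have h2 := ENNReal.Tendsto.const_mul (a := g r) (ENNReal.tendsto_ofReal h0) (Or.inr hr.ne)
    simpa using h2

theorem mem_NpLittle_of_dyadicSum_sphereSup {N : ℕ} {p : ℝ} (hp : 0 < p) (hpn : p ≤ (N + 1 : ℕ))
    {f : Cn (N + 1) → ℂ} (hf : DifferentiableOn ℂ f (ball 0 1))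
    {d : ℕ → ℕ} (hd : HadamardGaps d) {P : ℕ → MvPolynomial (Fin (N + 1)) ℂ}
    (hP : ∀ k, (P k).IsHomogeneous (d k))
    (hfP : ∀ z ∈ ball (0 : Cn (N + 1)) 1, HasSum (fun k => polyFun (P k) z) (f z))
    (ha : dyadicSum p d (fun k => sphereSup (P k)) < ∞) : f ∈ NpLittle (N + 1) p := by
  obtain ⟨C, hC, hle⟩ := exists_norm_sq_mul_le_radialMajorant hp hd hP hfP
  set g := radialMajorant p d fun k => sphereSup (P k)
  have hgm : Measurable g := measurable_radialMajorant _ _ _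
  have hgi : ∫⁻ r in Set.Ioo (0 : ℝ) 1, g r ≠ ∞ := by
    rw [lintegral_radialMajorant]
    exact (tsum_lt_top_of_dyadicSum_lt_top hp hd.1 ha).ne
  set K : ℝ≥0∞ := (volume (ball (0 : Cn (N + 1)) 1))⁻¹ *
      (C * (volume : Measure (Cn (N + 1))).toSphere Set.univ) with hK
  have hKt : K ≠ ∞ := ENNReal.mul_ne_top
    (ENNReal.inv_ne_top.2 (measure_ball_pos _ _ one_pos).ne')
    (ENNReal.mul_ne_top hC (measure_ne_top _ _))
  have hbound : ∀ a : Cn (N + 1), ‖a‖ < 1 → npIntegral p f a ≤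
      K * ∫⁻ r in Set.Ioo (0 : ℝ) 1, g r * ENNReal.ofReal (kernelBound p ‖a‖ r) :=
    fun a ha1 => npIntegral_le_lintegral_radial hp hpn hgm hle ha1
  refine ⟨⟨hf, ?_⟩, ?_⟩
  · have h1 : npNorm p f ≤ (K * ∫⁻ r in Set.Ioo (0 : ℝ) 1, g r) ^ (1 / 2 : ℝ) := by
      refine iSup₂_le fun a ha1 => ENNReal.rpow_le_rpow ?_ (by norm_num)
      refine (hbound a (mem_ball_zero_iff.1 ha1)).trans ?_
      gcongr with r
      exact mul_le_of_le_one_right' (ENNReal.ofReal_le_one.2 (min_le_left _ _))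
    exact h1.trans_lt (ENNReal.rpow_lt_top_of_nonneg (by norm_num) (ENNReal.mul_ne_top hKt hgi))
  · have h2 := ENNReal.Tendsto.const_mul (a := K)
      (tendsto_lintegral_mul_kernelBound hp hgm hgi) (Or.inr hKt)
    rw [mul_zero] at h2
    have h3 := h2.comp (tendsto_comap (f := fun a : Cn (N + 1) => ‖a‖))
    refine tendsto_of_tendsto_of_tendsto_of_le_of_le' tendsto_const_nhds h3
      (Eventually.of_forall fun _ => zero_le) ?_
    filter_upwards [preimage_mem_comap (self_mem_nhdsWithin (a := (1 : ℝ)) (s := Set.Iio 1))]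
      with a ha1
    exact hbound a ha1

end HadamardNp

open HadamardNp in
theorem theorem2p1 (n : ℕ) (p : ℝ) (hp : 0 < p) (hpn : p ≤ (n : ℝ))
    (f : Cn n → ℂ) (hf : DifferentiableOn ℂ f (Metric.ball 0 1))
    (d : ℕ → ℕ) (hd : HadamardGaps d)
    (P : ℕ → MvPolynomial (Fin n) ℂ) (hP : ∀ k, (P k).IsHomogeneous (d k))
    (hfP : ∀ z ∈ Metric.ball (0 : Cn n) 1,
      HasSum (fun k => MvPolynomial.eval (fun i => z i) (P k)) (f z)) :
    (dyadicSum p d (fun k => sphereSup (P k)) < ⊤ → f ∈ NpLittle n p) ∧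
    (f ∈ NpLittle n p → f ∈ Np n p) ∧
    (f ∈ Np n p → dyadicSum p d (fun k => sphereL2 (P k)) < ⊤) := by
  cases n with
  -- For `n = 0` the hypotheses `0 < p ≤ n` exclude each other.
  | zero => exact absurd (hp.trans_le hpn) (by simp)
  | succ N =>
    exact ⟨mem_NpLittle_of_dyadicSum_sphereSup hp hpn hf hd hP hfP, fun h => h.1,
      dyadicSum_sphereL2_lt_top hp hd.1.injective hP hfP⟩
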